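/- Let $k$ be a field of characteristic $p>2$, let $\mathfrak g=\mathfrak{sl}_2(k)$ with universal enveloping algebra $U=U(\mathfrak g)$, and let $S^n$ be the $n$-th symmetric power of the adjoint $\mathfrak g$-module, regarded as a $U$-module; let $k$ also denote the trivial $U$-module. Let $n\ge 0$ and write $n=qp+r$ with $0\le r\le p-1$. Then $\operatorname{Ext}^1_U(k,S^n)$ is a finite-dimensional $k$-vector space, and $$\dim_k \operatorname{Ext}^1_U(k,S^n)=\begin{cases}3\binom{q+2}{2} & \text{if } r=p-1,\\[2pt] 4\binom{q+1}{2}-\binom{q}{2} & \text{if } r\neq p-1 \text{ is even},\\[2pt] 3\binom{q+1}{2} & \text{if } r \text{ is odd}.\end{cases}$$ -/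

import Mathlib

open CategoryTheory

universe u v

noncomputable section

attribute [local instance 100] LieRing.ofAssociativeRing

namespace SymAdjoint

section General

variable (R : Type u) [CommRing R]

section Derivation

variable {M : Type v} [AddCommGroup M] [Module R M]

/-- The algebra map `S(M) → S(M)[ε]`, `m ↦ m + f(m) ε`. -/
def dualLift (f : M →ₗ[R] SymmetricAlgebra R M) :
    SymmetricAlgebra R M →ₐ[R] TrivSqZeroExt (SymmetricAlgebra R M) (SymmetricAlgebra R M) :=
  SymmetricAlgebra.lift
    ((TrivSqZeroExt.inlAlgHom R (SymmetricAlgebra R M) (SymmetricAlgebra R M)).toLinearMap ∘ₗ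
        SymmetricAlgebra.ι R M +
      (TrivSqZeroExt.inrHom (SymmetricAlgebra R M) (SymmetricAlgebra R M)).restrictScalars R ∘ₗ f)

lemma fst_dualLift (f : M →ₗ[R] SymmetricAlgebra R M) (a : SymmetricAlgebra R M) :
    (dualLift R f a).fst = a := by
  have h : (TrivSqZeroExt.fstHom R (SymmetricAlgebra R M) (SymmetricAlgebra R M)).comp
      (dualLift R f) = AlgHom.id R _ := by
    apply SymmetricAlgebra.algHom_ext
    ext m
    simp [dualLift]
  exact DFunLike.congr_fun h a

/-- The unique derivation of the symmetric algebra `S(M)` extending a given linear map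
`f : M → S(M)`. -/
def symDerivation (f : M →ₗ[R] SymmetricAlgebra R M) :
    Derivation R (SymmetricAlgebra R M) (SymmetricAlgebra R M) :=
  Derivation.mk'
    ((TrivSqZeroExt.sndHom (SymmetricAlgebra R M) (SymmetricAlgebra R M)).restrictScalars R ∘ₗ
      (dualLift R f).toLinearMap)
    (fun a b => by simp [fst_dualLift, mul_comm])

@[simp]
lemma symDerivation_ι (f : M →ₗ[R] SymmetricAlgebra R M) (m : M) :
    symDerivation R f (SymmetricAlgebra.ι R M m) = f m := by
  simp [symDerivation, dualLift]

lemma derivation_ext {D E : Derivation R (SymmetricAlgebra R M) (SymmetricAlgebra R M)}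
    (h : ∀ m, D (SymmetricAlgebra.ι R M m) = E (SymmetricAlgebra.ι R M m)) : D = E := by
  ext a
  induction a using SymmetricAlgebra.induction with
  | algebraMap r => simp
  | ι x => exact h x
  | mul a b ha hb => simp [ha, hb]
  | add a b ha hb => simp [ha, hb]

variable (M) in
/-- The `n`-th symmetric power `S^n(M)`: the degree `n` homogeneous part of the symmetric algebra,
spanned by the products of `n` elements of `M`. -/
def symPow (n : ℕ) : Submodule R (SymmetricAlgebra R M) :=
  LinearMap.range (SymmetricAlgebra.ι R M) ^ n

lemma symDerivation_mem (f : M →ₗ[R] M) (n : ℕ) {a : SymmetricAlgebra R M}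
    (ha : a ∈ symPow R M n) :
    symDerivation R (SymmetricAlgebra.ι R M ∘ₗ f) a ∈ symPow R M n := by
  unfold symPow at ha ⊢
  induction ha using Submodule.pow_induction_on_left' with
  | algebraMap r => simp
  | add x y i hx hy h1 h2 => rw [map_add]; exact add_mem h1 h2
  | mem_mul m hm i x hx h =>
    obtain ⟨m, rfl⟩ := hm
    rw [Derivation.leibniz, smul_eq_mul, smul_eq_mul, symDerivation_ι, pow_succ']
    refine add_mem (Submodule.mul_mem_mul ⟨m, rfl⟩ h) ?_
    rw [mul_comm x]
    exact Submodule.mul_mem_mul ⟨f m, rfl⟩ hx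

end Derivation

variable (L : Type v) [LieRing L] [LieAlgebra R L]

/-- The action of a Lie algebra on the symmetric algebra `S(L)` of its adjoint module:
`x` acts by the derivation extending `y ↦ ⁅x, y⁆`. -/
def symAd : L →ₗ⁅R⁆ Derivation R (SymmetricAlgebra R L) (SymmetricAlgebra R L) where
  toFun x := symDerivation R (SymmetricAlgebra.ι R L ∘ₗ LieModule.toEnd R L L x)
  map_add' x y := derivation_ext R fun m => by simp
  map_smul' c x := derivation_ext R fun m => by simp
  map_lie' {x y} := derivation_ext R fun m => by
    simp [Derivation.commutator_apply]

/-- The representation of `L` on the `n`-th symmetric power of its adjoint module. -/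
def symPowRep (n : ℕ) : L →ₗ⁅R⁆ Module.End R (symPow R L n) where
  toFun x := (symAd R L x).toLinearMap.restrict fun _ ha => symDerivation_mem R _ n ha
  map_add' x y := by
    ext a
    exact congrArg (fun D => D a.1) ((symAd R L).map_add x y)
  map_smul' c x := by
    ext a
    exact congrArg (fun D => D a.1) ((symAd R L).map_smul c x)
  map_lie' {x y} := by
    ext a
    have h := congrArg (fun D => D a.1) ((symAd R L).map_lie x y)
    simp only [Derivation.commutator_apply] at h
    exact h

/-- The module over the universal enveloping algebra `U(L)` given by a representation of `L`. -/
def envModule {V : Type (max u v)} [AddCommGroup V] [Module R V] (ρ : L →ₗ⁅R⁆ Module.End R V) :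
    ModuleCat.{max u v} (UniversalEnvelopingAlgebra R L) :=
  letI : Module (UniversalEnvelopingAlgebra R L) V :=
    Module.compHom V (UniversalEnvelopingAlgebra.lift R ρ).toRingHom
  ModuleCat.of (UniversalEnvelopingAlgebra R L) V

end General

variable (k : Type u) [Field k]

/-- The Lie algebra `𝔰𝔩₂(k)` of traceless `2 × 2` matrices. -/
abbrev sl2 : Type u := LieAlgebra.SpecialLinear.sl (Fin 2) k

/-- The universal enveloping algebra `U = U(𝔰𝔩₂(k))`. -/
abbrev U : Type u := UniversalEnvelopingAlgebra k (sl2 k)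

/-- The trivial `U`-module `k`, on which `𝔰𝔩₂(k)` acts by zero. -/
def triv : ModuleCat.{u} (U k) :=
  envModule k (sl2 k) (0 : sl2 k →ₗ⁅k⁆ Module.End k k)

/-- The `U`-module `S^n`, the `n`-th symmetric power of the adjoint module. -/
def S (n : ℕ) : ModuleCat.{u} (U k) :=
  envModule k (sl2 k) (symPowRep k (sl2 k) n)

end SymAdjoint

end

/-!
Since `0 → I → U → k → 0` is exact with `U` free and `I` the augmentation ideal, `Ext¹_U(k, V)` is
`Hom_U(I, V)` modulo the restrictions of maps `U → V`, that is, the `1`-cocycles of the Lie algebra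
modulo the coboundaries (`finite_and_finrank_ext_one`). For `𝔰𝔩₂` a cocycle is a triple of values at
`e`, `f`, `h`.

Let `c = h² + 4ef` be the Casimir element of the symmetric algebra `A`. The quotient `A / (c)` is the
ring of functions on the nilpotent cone, and its part of degree `n` is the module of binary forms of
degree `2n`. This gives an exact sequence `0 → S^{n-2} → S^n → (forms of degree 2n) → 0`. The
cohomology of the forms is elementary, because `e`, `f`, `h` act on monomials by simple scalars
(`exists_primitive`): with `n = qp + r` its dimension is `4q` if `r = 0`, `2q + 3` if `r = p - 1`, and
`0` otherwise.

The point is that all the invariants and all the cohomology classes of the forms lift to `S^n`, so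
that the connecting maps vanish and the dimension of `H¹(S^n)` is the sum of those of `H¹(S^{n-2})`
and of the cohomology of the forms (`finrank_cocycles_step`, `finrank_ext_add_two`). The invariants
lift to products of `e^p`, `f^p`, `h^p` (`exists_invariantLift`). The classes lift to multiples, by
these products, of a few explicit elements: powers of `e` and `f`, possibly times `h`
(`raisingLift_pow_mul`, `loweringLift_pow_mul`, `raisingLift_pow`, `loweringLift_pow`), and the
quotients `(c^{(p+1)/2} - h^{p+1}) / 4f`, `(c^{(p+1)/2} - h^{p+1}) / 4e` and
`h (c^{(p-1)/2} - h^{p-1}) / 4e` (`raisingLift_geom`, `loweringLift_geom`, `loweringLift_mul_geom`).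
The last three are exact divisions because `h² ≡ c` modulo `ef`, and `e` or `f` takes them to
invariants because the derivation kills `c` and `h^p`. Solving the recursion gives the stated
dimensions (`finrank_ext_eq`).
-/

noncomputable section

attribute [local instance 100] LieRing.ofAssociativeRing

namespace SymAdjoint

/-! ### The first cohomology of a Lie algebra and extensions of the trivial module -/

section LieCohomology

open ModuleCat

variable {k : Type u} [Field k] {L : Type u} [LieRing L] [LieAlgebra k L]
variable {V : Type u} [AddCommGroup V] [Module k V] (ρ : L →ₗ⁅k⁆ Module.End k V)

/-- The `1`-cocycles of `L` with values in the representation `ρ`. -/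
def lieCocycles : Submodule k (L →ₗ[k] V) where
  carrier := {φ | ∀ x y, φ ⁅x, y⁆ = ρ x (φ y) - ρ y (φ x)}
  add_mem' {φ ψ} hφ hψ x y := by
    simp only [LinearMap.add_apply, map_add, hφ x y, hψ x y]; abel
  zero_mem' x y := by simp
  smul_mem' c φ hφ x y := by
    simp only [LinearMap.smul_apply, map_smul, hφ x y, smul_sub]

/-- The map sending `v` to the coboundary `x ↦ ρ x v`. -/
def lieCoboundary : V →ₗ[k] (L →ₗ[k] V) := (ρ : L →ₗ[k] Module.End k V).flip

@[simp]
lemma lieCoboundary_apply (v : V) (x : L) : lieCoboundary ρ v x = ρ x v := rfl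

lemma lieCoboundary_mem (v : V) : lieCoboundary ρ v ∈ lieCocycles ρ := by
  intro x y
  simp [LieRing.of_associative_ring_bracket]

lemma envelopingAlgebra_induction {P : UniversalEnvelopingAlgebra k L → Prop}
    (algebraMap : ∀ r : k, P (algebraMap k _ r))
    (ι : ∀ x : L, P (UniversalEnvelopingAlgebra.ι k x))
    (mul : ∀ a b, P a → P b → P (a * b)) (add : ∀ a b, P a → P b → P (a + b))
    (a : UniversalEnvelopingAlgebra k L) : P a := by
  let s : Subalgebra k (UniversalEnvelopingAlgebra k L) :=
    { carrier := {a | P a}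
      mul_mem' := fun ha hb => mul _ _ ha hb
      add_mem' := fun ha hb => add _ _ ha hb
      algebraMap_mem' := algebraMap }
  let g : L →ₗ⁅k⁆ s :=
    { toFun := fun x => ⟨UniversalEnvelopingAlgebra.ι k x, ι x⟩
      map_add' := fun x y => Subtype.ext (by simp only [map_add]; rfl)
      map_smul' := fun c x => Subtype.ext (by simp only [map_smul]; rfl)
      map_lie' := fun {x y} => Subtype.ext (by simp only [LieHom.map_lie]; rfl) }
  have h : s.val.comp (UniversalEnvelopingAlgebra.lift k g) = AlgHom.id k _ := by
    apply UniversalEnvelopingAlgebra.hom_ext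
    ext x
    exact congrArg Subtype.val (UniversalEnvelopingAlgebra.lift_ι_apply k g x)
  have h2 := DFunLike.congr_fun h a
  change ((UniversalEnvelopingAlgebra.lift k g a : s) : _) = a at h2
  rw [← h2]
  exact (UniversalEnvelopingAlgebra.lift k g a).2

variable (k L) in
/-- The trivial module of `U(L)`. -/
abbrev trivEnv : ModuleCat.{u} (UniversalEnvelopingAlgebra k L) :=
  envModule k L (0 : L →ₗ⁅k⁆ Module.End k k)

variable (k L) in
/-- The augmentation `U(L) → k`. -/
def augmentation : UniversalEnvelopingAlgebra k L →ₗ[UniversalEnvelopingAlgebra k L] trivEnv k L :=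
  LinearMap.toSpanSingleton _ _ (show trivEnv k L from (1 : k))

/-- The augmentation with values in the field `k` itself. -/
def counit (u : UniversalEnvelopingAlgebra k L) : k :=
  UniversalEnvelopingAlgebra.lift k (0 : L →ₗ⁅k⁆ Module.End k k) u 1

lemma counit_ι (x : L) : counit (UniversalEnvelopingAlgebra.ι k x) = 0 := by
  rw [counit, UniversalEnvelopingAlgebra.lift_ι_apply]; rfl

lemma counit_algebraMap (r : k) :
    counit (algebraMap k (UniversalEnvelopingAlgebra k L) r) = r := by
  rw [counit, AlgHom.commutes]
  exact mul_one r

lemma counit_add (a b : UniversalEnvelopingAlgebra k L) :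
    counit (a + b) = counit a + counit b := by
  simp [counit]

lemma counit_mul (a b : UniversalEnvelopingAlgebra k L) :
    counit (a * b) = counit a * counit b := by
  have : counit b = counit b • (1 : k) := by simp
  rw [counit, map_mul, Module.End.mul_apply, ← counit, this, map_smul, ← counit, smul_eq_mul,
    smul_eq_mul, mul_one, mul_comm]

lemma augmentation_surjective : Function.Surjective (augmentation k L) :=
  fun r => ⟨algebraMap k _ (r : k), @counit_algebraMap k _ L _ _ r⟩

variable (k L) in
/-- The augmentation ideal of `U(L)`. -/
abbrev augIdeal : Submodule (UniversalEnvelopingAlgebra k L) (UniversalEnvelopingAlgebra k L) :=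
  LinearMap.ker (augmentation k L)

/-- The element of the augmentation ideal given by an element of the Lie algebra. -/
def augι (x : L) : augIdeal k L := ⟨UniversalEnvelopingAlgebra.ι k x, @counit_ι k _ L _ _ x⟩

/-- As a left ideal, the augmentation ideal is generated by the Lie algebra. -/
lemma augIdeal_le_span :
    augIdeal k L ≤ Submodule.span _ (Set.range (UniversalEnvelopingAlgebra.ι k : L → _)) := by
  set J := Submodule.span (UniversalEnvelopingAlgebra k L)
    (Set.range (UniversalEnvelopingAlgebra.ι k : L → _))
  have key : ∀ u : UniversalEnvelopingAlgebra k L,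
      ∃ r : k, u - algebraMap k (UniversalEnvelopingAlgebra k L) r ∈ J := by
    intro u
    induction u using envelopingAlgebra_induction with
    | algebraMap r => exact ⟨r, by simp⟩
    | ι x =>
      refine ⟨0, ?_⟩
      rw [map_zero, sub_zero]
      exact Submodule.subset_span ⟨x, rfl⟩
    | mul a b ha hb =>
      obtain ⟨r, hr⟩ := ha
      obtain ⟨s, hs⟩ := hb
      refine ⟨r * s, ?_⟩
      have : a * b - algebraMap k _ (r * s) =
          a • (b - algebraMap k _ s) +
            algebraMap k (UniversalEnvelopingAlgebra k L) s • (a - algebraMap k _ r) := by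
        simp only [smul_eq_mul, map_mul, mul_sub]
        rw [Algebra.commutes s a, Algebra.commutes s (algebraMap k _ r)]
        abel
      rw [this]
      exact add_mem (J.smul_mem _ hs) (J.smul_mem _ hr)
    | add a b ha hb =>
      obtain ⟨r, hr⟩ := ha
      obtain ⟨s, hs⟩ := hb
      refine ⟨r + s, ?_⟩
      rw [map_add, add_sub_add_comm]
      exact add_mem hr hs
  have hJ : J ≤ augIdeal k L := by
    rw [Submodule.span_le]
    rintro _ ⟨x, rfl⟩
    exact @counit_ι k _ L _ _ x
  intro u hu
  obtain ⟨r, hr⟩ := key u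
  have h1 : counit (u - algebraMap k (UniversalEnvelopingAlgebra k L) r) = 0 := hJ hr
  have h2 := counit_add (u - algebraMap k _ r) (algebraMap k (UniversalEnvelopingAlgebra k L) r)
  rw [sub_add_cancel, show counit u = 0 from hu, h1, counit_algebraMap, zero_add] at h2
  have : r = 0 := h2.symm
  simpa [this] using hr

/-- Restricting a `U(L)`-linear map on the augmentation ideal to the Lie algebra. -/
def restrictAug :
    (ModuleCat.of (UniversalEnvelopingAlgebra k L) (augIdeal k L) ⟶ envModule k L ρ) →ₗ[k]
      (L →ₗ[k] V) where
  toFun f :=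
    { toFun := fun x => f.hom (augι x)
      map_add' := fun x y => by
        have : (augι (x + y) : augIdeal k L) = augι x + augι y :=
          Subtype.ext (by simp only [augι, map_add]; rfl)
        rw [this, map_add]; rfl
      map_smul' := fun c x => by
        have : (augι (c • x) : augIdeal k L) =
            algebraMap k (UniversalEnvelopingAlgebra k L) c • augι x :=
          Subtype.ext (by simp only [augι, map_smul, Algebra.smul_def]; rfl)
        rw [this, map_smul]
        change UniversalEnvelopingAlgebra.lift k ρ (algebraMap k _ c) _ = _
        rw [AlgHom.commutes]; rfl }
  map_add' f g := rfl
  map_smul' c f := by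
    ext x
    change UniversalEnvelopingAlgebra.lift k ρ (algebraMap k _ c) _ = _
    rw [AlgHom.commutes]; rfl

lemma restrictAug_apply
    (f : ModuleCat.of (UniversalEnvelopingAlgebra k L) (augIdeal k L) ⟶ envModule k L ρ) (x : L) :
    restrictAug ρ f x = f.hom (augι x) := rfl

lemma restrictAug_injective : Function.Injective (restrictAug ρ) := by
  rw [injective_iff_map_eq_zero]
  intro f hf
  have h : augIdeal k L ≤ (LinearMap.ker f.hom).map (augIdeal k L).subtype := by
    refine augIdeal_le_span.trans ?_
    rw [Submodule.span_le]
    rintro _ ⟨x, rfl⟩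
    exact ⟨augι x, DFunLike.congr_fun hf x, rfl⟩
  ext ⟨u, hu⟩
  obtain ⟨w, hw, hwu⟩ := h hu
  have : w = ⟨u, hu⟩ := Subtype.ext hwu
  rw [← this]
  exact hw

lemma restrictAug_mem
    (f : ModuleCat.of (UniversalEnvelopingAlgebra k L) (augIdeal k L) ⟶ envModule k L ρ) :
    restrictAug ρ f ∈ lieCocycles ρ := by
  intro x y
  have h : (augι ⁅x, y⁆ : augIdeal k L) = UniversalEnvelopingAlgebra.ι k x • augι y -
      UniversalEnvelopingAlgebra.ι k y • augι x := Subtype.ext (by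
    simp only [augι, LieHom.map_lie, LieRing.of_associative_ring_bracket]; rfl)
  rw [restrictAug_apply, h, map_sub, map_smul, map_smul]
  change UniversalEnvelopingAlgebra.lift k ρ _ _ - UniversalEnvelopingAlgebra.lift k ρ _ _ = _
  rw [UniversalEnvelopingAlgebra.lift_ι_apply, UniversalEnvelopingAlgebra.lift_ι_apply]
  rfl

/-- The representation on `V × k` which is the extension of the trivial representation by `ρ`
given by a cocycle. -/
def cocycleExtension (φ : lieCocycles ρ) : L →ₗ⁅k⁆ Module.End k (V × k) where
  toFun x := (LinearMap.inl k V k) ∘ₗ ((ρ x).coprod (LinearMap.toSpanSingleton k V (φ.1 x)))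
  map_add' x y := by ext <;> simp
  map_smul' c x := by ext <;> simp
  map_lie' {x y} := by
    have h := φ.2 x y
    ext <;> simp [LieRing.of_associative_ring_bracket, h]

lemma lift_cocycleExtension (φ : lieCocycles ρ) (u : UniversalEnvelopingAlgebra k L) :
    (∀ v, UniversalEnvelopingAlgebra.lift k (cocycleExtension ρ φ) u (v, 0) =
      (UniversalEnvelopingAlgebra.lift k ρ u v, 0)) ∧
    (UniversalEnvelopingAlgebra.lift k (cocycleExtension ρ φ) u (0, 1)).2 = counit u := by
  induction u using envelopingAlgebra_induction with
  | algebraMap r =>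
    simp only [AlgHom.commutes, counit_algebraMap]
    constructor
    · intro v; simp [Algebra.algebraMap_eq_smul_one]
    · simp [Algebra.algebraMap_eq_smul_one]
  | ι x =>
    rw [counit_ι]
    simp only [UniversalEnvelopingAlgebra.lift_ι_apply]
    constructor
    · intro v; simp [cocycleExtension]
    · simp [cocycleExtension]
  | mul a b ha hb =>
    refine ⟨fun v => by simp [ha.1, hb.1], ?_⟩
    have key : ∀ v : V × k, (UniversalEnvelopingAlgebra.lift k (cocycleExtension ρ φ) a v).2 =
        v.2 * counit a := by
      intro v
      have : v = (v.1, 0) + v.2 • ((0, 1) : V × k) := by ext <;> simp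
      rw [this, map_add, map_smul, ha.1, Prod.snd_add, Prod.smul_snd, ha.2]
      simp
    rw [map_mul, Module.End.mul_apply, key, hb.2, counit_mul, mul_comm]
  | add a b ha hb =>
    refine ⟨fun v => by simp [ha.1, hb.1], ?_⟩
    simp only [map_add, LinearMap.add_apply, Prod.snd_add, ha.2, hb.2, counit_add]

lemma exists_restrictAug_eq (φ : lieCocycles ρ) : ∃ f, restrictAug ρ f = φ.1 := by
  let D : augIdeal k L →ₗ[UniversalEnvelopingAlgebra k L] envModule k L ρ :=
    { toFun := fun u => (UniversalEnvelopingAlgebra.lift k (cocycleExtension ρ φ) u.1 (0, 1)).1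
      map_add' := fun u w => by
        rw [Submodule.coe_add, map_add]; rfl
      map_smul' := fun u w => by
        have h2 := (lift_cocycleExtension ρ φ w.1).2
        rw [show counit w.1 = 0 from w.2] at h2
        have : UniversalEnvelopingAlgebra.lift k (cocycleExtension ρ φ) w.1 (0, 1) =
          ((UniversalEnvelopingAlgebra.lift k (cocycleExtension ρ φ) w.1 (0, 1)).1, 0) :=
          Prod.ext rfl h2
        simp only [Submodule.coe_smul, smul_eq_mul, map_mul, Module.End.mul_apply]
        rw [this, (lift_cocycleExtension ρ φ u).1]
        rfl }
  let f := ModuleCat.ofHom D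
  refine ⟨f, ?_⟩
  ext x
  change (UniversalEnvelopingAlgebra.lift k (cocycleExtension ρ φ)
    (UniversalEnvelopingAlgebra.ι k x) (0, 1)).1 = _
  rw [UniversalEnvelopingAlgebra.lift_ι_apply]
  simp [cocycleExtension]

/-- `Hom_{U(L)}(I, V)` is the space of `1`-cocycles, where `I` is the augmentation ideal. -/
def augHomEquiv :
    (ModuleCat.of (UniversalEnvelopingAlgebra k L) (augIdeal k L) ⟶ envModule k L ρ) ≃ₗ[k]
      lieCocycles ρ :=
  LinearEquiv.ofBijective ((restrictAug ρ).codRestrict _ (restrictAug_mem ρ))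
    ⟨fun _ _ h => restrictAug_injective ρ (congrArg Subtype.val h), fun φ => by
      obtain ⟨f, hf⟩ := exists_restrictAug_eq ρ φ
      exact ⟨f, Subtype.ext hf⟩⟩

/-- The cocycles map onto `Ext¹(k, V)`, with the coboundaries as kernel. -/
lemma exists_cocycles_to_ext :
    ∃ Φ : lieCocycles ρ →ₗ[k] Abelian.Ext (trivEnv k L) (envModule k L ρ) 1,
      Function.Surjective Φ ∧
        LinearMap.ker Φ = (LinearMap.range (lieCoboundary ρ)).comap (lieCocycles ρ).subtype := by
  have hS := LinearMap.shortExact_shortComplexKer (augmentation_surjective (k := k) (L := L))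
  set S := (augmentation k L).shortComplexKer
  let Ψ : (S.X₁ ⟶ envModule k L ρ) →ₗ[k] Abelian.Ext S.X₃ (envModule k L ρ) 1 :=
    Abelian.Ext.bilinearCompOfLinear k _ _ _ 1 0 1 rfl hS.extClass ∘ₗ
      (Abelian.Ext.linearEquiv₀ (R := k)).symm.toLinearMap
  have hΨ : ∀ f, Ψ f = hS.extClass.comp (Abelian.Ext.mk₀ f) (add_zero 1) := fun f => rfl
  refine ⟨Ψ ∘ₗ (augHomEquiv ρ).symm.toLinearMap, ?_, ?_⟩
  · rw [LinearMap.coe_comp]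
    refine Function.Surjective.comp (fun x => ?_) (augHomEquiv ρ).symm.surjective
    have hP : Projective S.X₂ := by
      exact ModuleCat.projective_of_categoryTheory_projective _
    have := Abelian.Ext.subsingleton_of_projective S.X₂ (envModule k L ρ) 0
    obtain ⟨y, hy⟩ := Abelian.Ext.contravariant_sequence_exact₃ hS _ x (Subsingleton.elim _ _)
      (add_zero 1)
    refine ⟨Abelian.Ext.linearEquiv₀ (R := k) y, ?_⟩
    rw [hΨ, Abelian.Ext.mk₀_linearEquiv₀_apply, hy]
  · ext φ
    obtain ⟨f, rfl⟩ := (augHomEquiv ρ).surjective φ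
    rw [LinearMap.mem_ker, LinearMap.comp_apply, LinearEquiv.coe_coe,
      LinearEquiv.symm_apply_apply, hΨ, Submodule.mem_comap, LinearMap.mem_range]
    constructor
    · intro h
      obtain ⟨y, hy⟩ := Abelian.Ext.contravariant_sequence_exact₁ hS _ _ _ h
      obtain ⟨g, rfl⟩ := Abelian.Ext.addEquiv₀.symm.surjective y
      change (Abelian.Ext.mk₀ S.f).comp (Abelian.Ext.mk₀ g) _ = _ at hy
      rw [Abelian.Ext.mk₀_comp_mk₀] at hy
      have hfg := (Abelian.Ext.mk₀_bijective _ _).1 hy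
      refine ⟨g.hom (1 : UniversalEnvelopingAlgebra k L), ?_⟩
      ext x
      change _ = f.hom (augι x)
      rw [← hfg]
      change _ = g.hom (UniversalEnvelopingAlgebra.ι k x : UniversalEnvelopingAlgebra k L)
      have h1 : (UniversalEnvelopingAlgebra.ι k x : UniversalEnvelopingAlgebra k L) =
        UniversalEnvelopingAlgebra.ι k x • (1 : UniversalEnvelopingAlgebra k L) := by simp
      conv_rhs => rw [h1]
      refine Eq.trans ?_ (map_smul g.hom _ _).symm
      change _ = UniversalEnvelopingAlgebra.lift k ρ _ _
      rw [UniversalEnvelopingAlgebra.lift_ι_apply]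
      rfl
    · rintro ⟨v, hv⟩
      let g₀ := ModuleCat.ofHom (LinearMap.toSpanSingleton (UniversalEnvelopingAlgebra k L)
        (envModule k L ρ) (show envModule k L ρ from v))
      let g : S.X₂ ⟶ envModule k L ρ := g₀
      have hfg : f = S.f ≫ g := by
        apply restrictAug_injective ρ
        ext x
        have h1 := DFunLike.congr_fun hv x
        refine Eq.trans h1.symm ?_
        change _ = UniversalEnvelopingAlgebra.lift k ρ (UniversalEnvelopingAlgebra.ι k x) v
        rw [UniversalEnvelopingAlgebra.lift_ι_apply]
        rfl
      rw [hfg, ← Abelian.Ext.mk₀_comp_mk₀, hS.extClass_comp_assoc]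

/-- `Ext¹(k, V)` is the space of cocycles modulo coboundaries. -/
theorem finite_and_finrank_ext_one [Module.Finite k V] [Module.Finite k L] :
    Module.Finite k (Abelian.Ext (trivEnv k L) (envModule k L ρ) 1) ∧
    Module.finrank k (Abelian.Ext (trivEnv k L) (envModule k L ρ) 1) +
      Module.finrank k (LinearMap.range (lieCoboundary ρ)) = Module.finrank k (lieCocycles ρ) := by
  obtain ⟨Φ, hs, hk⟩ := exists_cocycles_to_ext ρ
  refine ⟨Module.Finite.of_surjective Φ hs, ?_⟩
  have h1 := LinearMap.finrank_range_add_finrank_ker Φ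
  rw [LinearMap.range_eq_top.2 hs, finrank_top, hk] at h1
  have hle : LinearMap.range (lieCoboundary ρ) ≤ lieCocycles ρ := by
    rintro _ ⟨v, rfl⟩; exact lieCoboundary_mem ρ v
  rwa [(Submodule.comapSubtypeEquivOfLe hle).finrank_eq] at h1

end LieCohomology

/-! ### The symmetric algebra of `𝔰𝔩₂` and its cocycles -/

section Sl2

variable (k : Type u) [Field k]

/-- The matrix `e`. -/
def matE : sl2 k := ⟨!![0, 1; 0, 0], by
  simp [LieAlgebra.SpecialLinear.sl, Matrix.trace_fin_two]⟩

/-- The matrix `f`. -/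
def matF : sl2 k := ⟨!![0, 0; 1, 0], by
  simp [LieAlgebra.SpecialLinear.sl, Matrix.trace_fin_two]⟩

/-- The matrix `h`. -/
def matH : sl2 k := ⟨!![1, 0; 0, -1], by
  simp [LieAlgebra.SpecialLinear.sl, Matrix.trace_fin_two]⟩

variable {k}

lemma sl2_apply_one_one (x : sl2 k) : x.1 1 1 = -x.1 0 0 := by
  have h : Matrix.trace x.1 = 0 := by
    exact x.2
  rw [Matrix.trace_fin_two] at h
  linear_combination h

lemma sl2_eq (x : sl2 k) : x = x.1 0 1 • matE k + x.1 1 0 • matF k + x.1 0 0 • matH k := by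
  apply Subtype.ext
  ext i j
  fin_cases i <;> fin_cases j <;> simp [matE, matF, matH, sl2_apply_one_one]

lemma lie_matE_matF : ⁅matE k, matF k⁆ = matH k := by
  apply Subtype.ext
  ext i j
  fin_cases i <;> fin_cases j <;>
    simp [matE, matF, matH, LieRing.of_associative_ring_bracket]

lemma lie_matH_matE : ⁅matH k, matE k⁆ = (2 : k) • matE k := by
  apply Subtype.ext
  ext i j
  fin_cases i <;> fin_cases j <;>
    simp [matE, matH, LieRing.of_associative_ring_bracket]
  norm_num

lemma lie_matH_matF : ⁅matH k, matF k⁆ = -((2 : k) • matF k) := by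
  apply Subtype.ext
  ext i j
  fin_cases i <;> fin_cases j <;>
    simp [matF, matH, LieRing.of_associative_ring_bracket]
  norm_num

lemma lie_matF_matH : ⁅matF k, matH k⁆ = (2 : k) • matF k := by
  rw [← lie_skew, lie_matH_matF, neg_neg]

variable (k)

/-- The symmetric algebra of `𝔰𝔩₂(k)`. -/
abbrev SA : Type u := SymmetricAlgebra k (sl2 k)

/-- `e` as an element of the symmetric algebra. -/
def genE : SA k := SymmetricAlgebra.ι k _ (matE k)
/-- `f` as an element of the symmetric algebra. -/
def genF : SA k := SymmetricAlgebra.ι k _ (matF k)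
/-- `h` as an element of the symmetric algebra. -/
def genH : SA k := SymmetricAlgebra.ι k _ (matH k)
/-- The Casimir element `h² + 4ef`. -/
def casimir : SA k := genH k ^ 2 + 4 * (genE k * genF k)

/-- The derivation of the symmetric algebra by which `e` acts. -/
def derE : Derivation k (SA k) (SA k) := symAd k (sl2 k) (matE k)
/-- The derivation of the symmetric algebra by which `f` acts. -/
def derF : Derivation k (SA k) (SA k) := symAd k (sl2 k) (matF k)
/-- The derivation of the symmetric algebra by which `h` acts. -/
def derH : Derivation k (SA k) (SA k) := symAd k (sl2 k) (matH k)

variable {k}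

lemma two_smul_eq_mul (a : SA k) : (2 : k) • a = 2 * a := by rw [two_smul, two_mul]

lemma symAd_ι (x y : sl2 k) : symAd k (sl2 k) x (SymmetricAlgebra.ι k _ y) =
    SymmetricAlgebra.ι k _ ⁅x, y⁆ := symDerivation_ι _ _ _

@[simp] lemma derE_genE : derE k (genE k) = 0 := by
  rw [derE, genE, symAd_ι, lie_self, map_zero]
@[simp] lemma derE_genF : derE k (genF k) = genH k := by
  rw [derE, genF, symAd_ι, lie_matE_matF, genH]
@[simp] lemma derE_genH : derE k (genH k) = -2 * genE k := by
  rw [derE, genH, symAd_ι, ← lie_skew, lie_matH_matE, map_neg, map_smul, genE, two_smul_eq_mul, neg_mul]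
@[simp] lemma derF_genE : derF k (genE k) = -genH k := by
  rw [derF, genE, symAd_ι, ← lie_skew, lie_matE_matF, genH, map_neg]
@[simp] lemma derF_genF : derF k (genF k) = 0 := by
  rw [derF, genF, symAd_ι, lie_self, map_zero]
@[simp] lemma derF_genH : derF k (genH k) = 2 * genF k := by
  rw [derF, genH, symAd_ι, ← lie_skew, lie_matH_matF, neg_neg, map_smul, genF, two_smul_eq_mul]
@[simp] lemma derH_genE : derH k (genE k) = 2 * genE k := by
  rw [derH, genE, symAd_ι, lie_matH_matE, map_smul, two_smul_eq_mul]
@[simp] lemma derH_genF : derH k (genF k) = -2 * genF k := by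
  rw [derH, genF, symAd_ι, lie_matH_matF, map_neg, map_smul, two_smul_eq_mul, neg_mul]
@[simp] lemma derH_genH : derH k (genH k) = 0 := by
  rw [derH, genH, symAd_ι, lie_self, map_zero]

lemma derE_derF (a : SA k) : derE k (derF k a) - derF k (derE k a) = derH k a := by
  rw [derE, derF, derH, ← lie_matE_matF, LieHom.map_lie, Derivation.commutator_apply]

lemma derH_derE (a : SA k) : derH k (derE k a) - derE k (derH k a) = 2 * derE k a := by
  have h := congrArg (fun D => D a) ((symAd k (sl2 k)).map_lie (matH k) (matE k))
  simp only [lie_matH_matE, Derivation.commutator_apply, map_smul, Derivation.smul_apply] at h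
  rw [derE, derH, ← h, two_smul_eq_mul]

lemma derH_derF (a : SA k) : derH k (derF k a) - derF k (derH k a) = -2 * derF k a := by
  have h := congrArg (fun D => D a) ((symAd k (sl2 k)).map_lie (matH k) (matF k))
  simp only [lie_matH_matF, Derivation.commutator_apply, map_neg, map_smul, Derivation.neg_apply,
    Derivation.smul_apply] at h
  rw [derF, derH, ← h, two_smul_eq_mul, neg_mul]

lemma symAd_eq (x : sl2 k) (a : SA k) : symAd k (sl2 k) x a =
    x.1 0 1 • derE k a + x.1 1 0 • derF k a + x.1 0 0 • derH k a := by
  conv_lhs => rw [sl2_eq x]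
  simp [derE, derF, derH]

/-- The invariants of the symmetric algebra. -/
def invariants (k : Type u) [Field k] : Subalgebra k (SA k) where
  carrier := {a | derE k a = 0 ∧ derF k a = 0 ∧ derH k a = 0}
  mul_mem' {a b} ha hb := by simp_all
  add_mem' {a b} ha hb := by simp_all
  algebraMap_mem' r := by simp

lemma casimir_mem_invariants : casimir k ∈ invariants k := by
  have h4 (D : Derivation k (SA k) (SA k)) : D 4 = 0 := D.map_natCast 4
  refine ⟨?_, ?_, ?_⟩ <;>
    simp only [casimir, map_add, Derivation.leibniz, Derivation.leibniz_pow, smul_eq_mul, h4,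
      derE_genE, derE_genF, derE_genH, derF_genE, derF_genF, derF_genH, derH_genE, derH_genF,
      derH_genH, nsmul_eq_mul] <;> push_cast <;> ring

lemma genE_mem : genE k ∈ symPow k (sl2 k) 1 := by
  rw [symPow, pow_one]; exact ⟨_, rfl⟩
lemma genF_mem : genF k ∈ symPow k (sl2 k) 1 := by
  rw [symPow, pow_one]; exact ⟨_, rfl⟩
lemma genH_mem : genH k ∈ symPow k (sl2 k) 1 := by
  rw [symPow, pow_one]; exact ⟨_, rfl⟩

lemma mul_mem_symPow {m n : ℕ} {a b : SA k} (ha : a ∈ symPow k (sl2 k) m)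
    (hb : b ∈ symPow k (sl2 k) n) : a * b ∈ symPow k (sl2 k) (m + n) := by
  rw [symPow, pow_add]; exact Submodule.mul_mem_mul ha hb

lemma pow_mem_symPow {m : ℕ} {a : SA k} (ha : a ∈ symPow k (sl2 k) m) (n : ℕ) :
    a ^ n ∈ symPow k (sl2 k) (m * n) := by
  rw [symPow, pow_mul]; exact Submodule.pow_mem_pow _ ha n

lemma natCast_mul_mem_symPow {m : ℕ} {a : SA k} (ha : a ∈ symPow k (sl2 k) m) (c : ℕ) :
    (c : SA k) * a ∈ symPow k (sl2 k) m := by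
  rw [← nsmul_eq_mul]; exact nsmul_mem ha c

lemma casimir_mem : casimir k ∈ symPow k (sl2 k) 2 := by
  have h := natCast_mul_mem_symPow (mul_mem_symPow (genE_mem (k := k)) genF_mem) 4
  exact add_mem (pow_mem_symPow genH_mem 2) (by exact_mod_cast h)

lemma derE_mem {n : ℕ} {a : SA k} (ha : a ∈ symPow k (sl2 k) n) :
    derE k a ∈ symPow k (sl2 k) n := symDerivation_mem k _ n ha
lemma derF_mem {n : ℕ} {a : SA k} (ha : a ∈ symPow k (sl2 k) n) :
    derF k a ∈ symPow k (sl2 k) n := symDerivation_mem k _ n ha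
lemma derH_mem {n : ℕ} {a : SA k} (ha : a ∈ symPow k (sl2 k) n) :
    derH k a ∈ symPow k (sl2 k) n := symDerivation_mem k _ n ha

instance symPow_finite (n : ℕ) : Module.Finite k (symPow k (sl2 k) n) := by
  rw [Module.Finite.iff_fg]
  exact Submodule.FG.pow (Module.Finite.iff_fg.1 inferInstance) n

lemma exists_eq_of_mem_symPow_succ {n : ℕ} {a : SA k} (ha : a ∈ symPow k (sl2 k) (n + 1)) :
    ∃ x ∈ symPow k (sl2 k) n, ∃ y ∈ symPow k (sl2 k) n, ∃ z ∈ symPow k (sl2 k) n,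
      a = genE k * x + genF k * y + genH k * z := by
  rw [symPow, pow_succ'] at ha
  induction ha using Submodule.mul_induction_on' with
  | mem_mul_mem m hm b hb =>
    obtain ⟨m, rfl⟩ := hm
    refine ⟨m.1 0 1 • b, Submodule.smul_mem _ _ hb, m.1 1 0 • b, Submodule.smul_mem _ _ hb,
      m.1 0 0 • b, Submodule.smul_mem _ _ hb, ?_⟩
    conv_lhs => rw [sl2_eq m]
    simp [genE, genF, genH, add_mul]
  | add a _ b _ h1 h2 =>
    obtain ⟨x, hx, y, hy, z, hz, rfl⟩ := h1
    obtain ⟨x', hx', y', hy', z', hz', rfl⟩ := h2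
    exact ⟨_, add_mem hx hx', _, add_mem hy hy', _, add_mem hz hz', by ring⟩

/-- The `1`-cocycles with values in `S^n`, written as triples of values at `e`, `f`, `h`. -/
def cocycles (k : Type u) [Field k] (n : ℕ) : Submodule k (SA k × SA k × SA k) where
  carrier := {z | (z.1 ∈ symPow k (sl2 k) n ∧ z.2.1 ∈ symPow k (sl2 k) n ∧
      z.2.2 ∈ symPow k (sl2 k) n) ∧ z.2.2 = derE k z.2.1 - derF k z.1 ∧
      2 * z.1 = derH k z.1 - derE k z.2.2 ∧ -2 * z.2.1 = derH k z.2.1 - derF k z.2.2}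
  add_mem' {z w} hz hw := by
    obtain ⟨⟨h1, h2, h3⟩, h4, h5, h6⟩ := hz
    obtain ⟨⟨g1, g2, g3⟩, g4, g5, g6⟩ := hw
    refine ⟨⟨add_mem h1 g1, add_mem h2 g2, add_mem h3 g3⟩, ?_, ?_, ?_⟩ <;>
      simp only [Prod.fst_add, Prod.snd_add, map_add]
    · linear_combination h4 + g4
    · linear_combination h5 + g5
    · linear_combination h6 + g6
  zero_mem' := by simp
  smul_mem' c z hz := by
    obtain ⟨⟨h1, h2, h3⟩, h4, h5, h6⟩ := hz
    refine ⟨⟨Submodule.smul_mem _ c h1, Submodule.smul_mem _ c h2, Submodule.smul_mem _ c h3⟩,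
      ?_, ?_, ?_⟩ <;>
      simp only [Prod.smul_fst, Prod.smul_snd, Derivation.map_smul, mul_smul_comm, ← smul_sub]
    · rw [h4]
    · rw [h5]
    · rw [h6]

variable (k) in
/-- The coboundary map `a ↦ (e a, f a, h a)`. -/
def coboundary : SA k →ₗ[k] SA k × SA k × SA k :=
  (derE k).toLinearMap.prod ((derF k).toLinearMap.prod (derH k).toLinearMap)

@[simp] lemma coboundary_apply (a : SA k) :
    coboundary k a = (derE k a, derF k a, derH k a) := rfl

/-- The `1`-coboundaries with values in `S^n`. -/
def coboundaries (k : Type u) [Field k] (n : ℕ) : Submodule k (SA k × SA k × SA k) :=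
  (symPow k (sl2 k) n).map (coboundary k)

lemma coboundaries_le_cocycles (n : ℕ) : coboundaries k n ≤ cocycles k n := by
  rintro _ ⟨a, ha, rfl⟩
  exact ⟨⟨derE_mem ha, derF_mem ha, derH_mem ha⟩, (derE_derF a).symm, (derH_derE a).symm,
    (derH_derF a).symm⟩

instance cocycles_finite (n : ℕ) : Module.Finite k (cocycles k n) := by
  have hle : cocycles k n ≤ (symPow k (sl2 k) n).prod
    ((symPow k (sl2 k) n).prod (symPow k (sl2 k) n)) := fun z hz => hz.1
  have : Module.Finite k ((symPow k (sl2 k) n).prod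
    ((symPow k (sl2 k) n).prod (symPow k (sl2 k) n))) := by
    rw [Module.Finite.iff_fg]
    have h := Module.Finite.iff_fg.1 (symPow_finite (k := k) n)
    exact h.prod (h.prod h)
  exact Submodule.finiteDimensional_of_le hle

instance coboundaries_finite (n : ℕ) : Module.Finite k (coboundaries k n) :=
  Submodule.finiteDimensional_of_le (coboundaries_le_cocycles n)

/-- The values of a linear map at `e`, `f`, `h`. -/
def evalTriple (n : ℕ) : (sl2 k →ₗ[k] symPow k (sl2 k) n) →ₗ[k] SA k × SA k × SA k where
  toFun φ := ((φ (matE k)).1, (φ (matF k)).1, (φ (matH k)).1)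
  map_add' _ _ := rfl
  map_smul' _ _ := rfl

lemma evalTriple_injective (n : ℕ) : Function.Injective (evalTriple (k := k) n) := by
  intro φ ψ h
  ext x
  have h1 := congrArg Prod.fst h
  have h2 := congrArg (fun t => t.2.1) h
  have h3 := congrArg (fun t => t.2.2) h
  simp only [evalTriple, LinearMap.coe_mk, AddHom.coe_mk] at h1 h2 h3
  rw [sl2_eq x]
  simp [h1, h2, h3]

lemma symPowRep_apply_coe (n : ℕ) (x : sl2 k) (a : symPow k (sl2 k) n) :
    ((symPowRep k (sl2 k) n x a : symPow k (sl2 k) n) : SA k) = symAd k (sl2 k) x a := rfl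

lemma evalTriple_mem_cocycles (n : ℕ) {φ : sl2 k →ₗ[k] symPow k (sl2 k) n}
    (hφ : φ ∈ lieCocycles (symPowRep k (sl2 k) n)) : evalTriple n φ ∈ cocycles k n := by
  refine ⟨⟨(φ _).2, (φ _).2, (φ _).2⟩, ?_, ?_, ?_⟩
  · have h := congrArg Subtype.val (hφ (matE k) (matF k))
    rwa [lie_matE_matF] at h
  · have h := congrArg Subtype.val (hφ (matH k) (matE k))
    rwa [lie_matH_matE, φ.map_smul 2 (matE k), Submodule.coe_smul, two_smul_eq_mul] at h
  · have h2 : φ ⁅matF k, matH k⁆ = (2 : k) • φ (matF k) :=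
      (congrArg φ lie_matF_matH).trans (φ.map_smul 2 (matF k))
    have h3 := congrArg Subtype.val (h2.symm.trans (hφ (matF k) (matH k)))
    have h4 : (2 : k) • (φ (matF k) : SA k) =
      symAd k (sl2 k) (matF k) (φ (matH k)) - symAd k (sl2 k) (matH k) (φ (matF k)) := h3
    change -2 * (φ (matF k) : SA k) =
      symAd k (sl2 k) (matH k) (φ (matF k)) - symAd k (sl2 k) (matF k) (φ (matH k))
    rw [two_smul_eq_mul] at h4
    linear_combination -h4

lemma lie_apply_zero_one (x y : sl2 k) :
    (⁅x, y⁆ : sl2 k).1 0 1 = 2 * (x.1 0 0 * y.1 0 1 - y.1 0 0 * x.1 0 1) := by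
  simp [LieRing.of_associative_ring_bracket, Matrix.mul_apply, sl2_apply_one_one]; ring

lemma lie_apply_one_zero (x y : sl2 k) :
    (⁅x, y⁆ : sl2 k).1 1 0 = -2 * (x.1 0 0 * y.1 1 0 - y.1 0 0 * x.1 1 0) := by
  simp [LieRing.of_associative_ring_bracket, Matrix.mul_apply, sl2_apply_one_one]; ring

lemma lie_apply_zero_zero (x y : sl2 k) :
    (⁅x, y⁆ : sl2 k).1 0 0 = x.1 0 1 * y.1 1 0 - y.1 0 1 * x.1 1 0 := by
  simp [LieRing.of_associative_ring_bracket, Matrix.mul_apply]; ring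

lemma exists_evalTriple_eq (n : ℕ) {z : SA k × SA k × SA k} (hz : z ∈ cocycles k n) :
    ∃ φ ∈ lieCocycles (symPowRep k (sl2 k) n), evalTriple n φ = z := by
  obtain ⟨⟨h1, h2, h3⟩, h4, h5, h6⟩ := hz
  obtain ⟨a, b, c⟩ := z
  dsimp only at h1 h2 h3 h4 h5 h6
  let φ : sl2 k →ₗ[k] symPow k (sl2 k) n :=
    { toFun := fun x => x.1 0 1 • ⟨a, h1⟩ + x.1 1 0 • ⟨b, h2⟩ + x.1 0 0 • ⟨c, h3⟩
      map_add' := fun x y => by simp [add_smul]; abel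
      map_smul' := fun r x => by simp [mul_smul] }
  have hφ (x : sl2 k) : (φ x : SA k) = x.1 0 1 • a + x.1 1 0 • b + x.1 0 0 • c := rfl
  refine ⟨φ, ?_, ?_⟩
  · intro x y
    apply Subtype.ext
    rw [AddSubgroupClass.coe_sub, symPowRep_apply_coe, symPowRep_apply_coe, symAd_eq, symAd_eq,
      hφ, hφ, hφ, lie_apply_zero_one, lie_apply_one_zero, lie_apply_zero_zero]
    generalize x.1 0 0 = x0
    generalize x.1 0 1 = x1
    generalize x.1 1 0 = x2
    generalize y.1 0 0 = y0
    generalize y.1 0 1 = y1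
    generalize y.1 1 0 = y2
    simp only [map_add, Derivation.map_smul]
    rw [← two_smul_eq_mul] at h5
    rw [neg_mul, ← two_smul_eq_mul] at h6
    linear_combination (norm := module) (x1 * y2 - y1 * x2) • h4 + (x0 * y1 - y0 * x1) • h5 +
      (x0 * y2 - y0 * x2) • h6
  · simp only [evalTriple, LinearMap.coe_mk, AddHom.coe_mk, hφ]
    simp [matE, matF, matH]

lemma map_evalTriple_lieCocycles (n : ℕ) :
    (lieCocycles (symPowRep k (sl2 k) n)).map (evalTriple n) = cocycles k n := by
  ext z
  constructor
  · rintro ⟨φ, hφ, rfl⟩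
    exact evalTriple_mem_cocycles n hφ
  · exact exists_evalTriple_eq n

lemma map_evalTriple_range (n : ℕ) :
    (LinearMap.range (lieCoboundary (symPowRep k (sl2 k) n))).map (evalTriple n) =
      coboundaries k n := by
  ext z
  constructor
  · rintro ⟨_, ⟨a, rfl⟩, rfl⟩
    exact ⟨a.1, a.2, rfl⟩
  · rintro ⟨a, ha, rfl⟩
    exact ⟨_, ⟨⟨a, ha⟩, rfl⟩, rfl⟩

theorem finrank_ext_add_finrank_coboundaries (n : ℕ) :
    Module.Finite k (Abelian.Ext (triv k) (S k n) 1) ∧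
    Module.finrank k (Abelian.Ext (triv k) (S k n) 1) +
      Module.finrank k (coboundaries k n) = Module.finrank k (cocycles k n) := by
  have h := finite_and_finrank_ext_one (symPowRep k (sl2 k) n)
  rw [← map_evalTriple_lieCocycles, ← map_evalTriple_range,
    ← (Submodule.equivMapOfInjective _ (evalTriple_injective n) _).finrank_eq,
    ← (Submodule.equivMapOfInjective _ (evalTriple_injective n) _).finrank_eq]
  exact h

end Sl2

/-! ### Restriction to the nilpotent cone -/

section Cone

open Polynomial

variable {k : Type u} [Field k]

variable (k) in
/-- Restriction to the nilpotent cone, which is parametrized by `e ↦ -u²`, `h ↦ 2uv`, `f ↦ v²`;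
the functions of `u`, `v` are dehomogenized by `v = 1`, `u = X`. -/
def coneMap : SA k →ₐ[k] k[X] :=
  SymmetricAlgebra.lift
    { toFun := fun x => x.1 0 1 • (-X ^ 2) + x.1 1 0 • 1 + x.1 0 0 • (2 * X)
      map_add' := fun x y => by simp [add_smul]; ring
      map_smul' := fun c x => by simp [mul_smul] }

@[simp] lemma coneMap_genE : coneMap k (genE k) = -X ^ 2 := by
  simp [coneMap, genE, matE]
@[simp] lemma coneMap_genF : coneMap k (genF k) = 1 := by
  simp [coneMap, genF, matF]
@[simp] lemma coneMap_genH : coneMap k (genH k) = 2 * X := by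
  simp [coneMap, genH, matH]
@[simp] lemma coneMap_casimir : coneMap k (casimir k) = 0 := by
  simp only [casimir, map_add, map_mul, map_pow, coneMap_genE, coneMap_genF, coneMap_genH,
    map_ofNat]
  ring

/-- The action of `e` on forms of degree `2n` in `u`, `v`. -/
def opE (n : ℕ) (g : k[X]) : k[X] := C (2 * n : k) * (X * g) - X ^ 2 * derivative g
/-- The action of `f` on forms of degree `2n` in `u`, `v`. -/
def opF (g : k[X]) : k[X] := derivative g
/-- The action of `h` on forms of degree `2n` in `u`, `v`. -/
def opH (n : ℕ) (g : k[X]) : k[X] := C 2 * (X * derivative g) - C (2 * n : k) * g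

lemma coeff_opE_zero (n : ℕ) (g : k[X]) : (opE n g).coeff 0 = 0 := by
  simp [opE, mul_coeff_zero]

lemma coeff_opE_succ (n : ℕ) (g : k[X]) (i : ℕ) :
    (opE n g).coeff (i + 1) = (2 * n - i) * g.coeff i := by
  rw [opE, coeff_sub, coeff_C_mul, coeff_X_mul, pow_two, mul_assoc X X, coeff_X_mul]
  cases i with
  | zero => simp
  | succ i => rw [coeff_X_mul, coeff_derivative]; push_cast; ring

lemma coeff_opF (g : k[X]) (i : ℕ) : (opF g).coeff i = (i + 1) * g.coeff (i + 1) := by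
  rw [opF, coeff_derivative, mul_comm]

lemma coeff_opH (n : ℕ) (g : k[X]) (i : ℕ) :
    (opH n g).coeff i = (2 * i - 2 * n) * g.coeff i := by
  rw [opH, coeff_sub, coeff_C_mul, coeff_C_mul]
  cases i with
  | zero => simp
  | succ i => rw [coeff_X_mul, coeff_derivative]; push_cast; ring

/-- The restriction to the cone intertwines the actions of `e`, `f`, `h`. -/
lemma coneMap_der {n : ℕ} {a : SA k} (ha : a ∈ symPow k (sl2 k) n) :
    coneMap k (derE k a) = opE n (coneMap k a) ∧ coneMap k (derF k a) = opF (coneMap k a) ∧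
      coneMap k (derH k a) = opH n (coneMap k a) := by
  induction n generalizing a with
  | zero =>
    rw [symPow, pow_zero, Submodule.mem_one] at ha
    obtain ⟨r, rfl⟩ := ha
    simp [opE, opF, opH]
  | succ n ih =>
    obtain ⟨x, hx, y, hy, z, hz, rfl⟩ := exists_eq_of_mem_symPow_succ ha
    obtain ⟨x1, x2, x3⟩ := ih hx
    obtain ⟨y1, y2, y3⟩ := ih hy
    obtain ⟨z1, z2, z3⟩ := ih hz
    refine ⟨?_, ?_, ?_⟩ <;>
    · simp only [map_add, map_mul, Derivation.leibniz, smul_eq_mul, derE_genE, derE_genF,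
        derE_genH, derF_genE, derF_genF, derF_genH, derH_genE, derH_genF, derH_genH, coneMap_genE,
        coneMap_genF, coneMap_genH, x1, x2, x3, y1, y2, y3, z1, z2, z3, map_neg, map_zero,
        opE, opF, opH, derivative_mul, derivative_X_pow,
        derivative_X, derivative_one, derivative_ofNat, map_ofNat]
      push_cast
      simp only [map_ofNat, map_add, map_natCast, map_one]
      ring

lemma natDegree_coneMap_le {n : ℕ} {a : SA k} (ha : a ∈ symPow k (sl2 k) n) :
    (coneMap k a).natDegree ≤ 2 * n := by
  induction n generalizing a with
  | zero =>
    rw [symPow, pow_zero, Submodule.mem_one] at ha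
    obtain ⟨r, rfl⟩ := ha
    rw [AlgHom.commutes]
    simp
  | succ n ih =>
    obtain ⟨x, hx, y, hy, z, hz, rfl⟩ := exists_eq_of_mem_symPow_succ ha
    simp only [map_add, map_mul, coneMap_genE, coneMap_genF, coneMap_genH]
    have h1 : (-X ^ 2 : k[X]).natDegree ≤ 2 := by simp
    have h2 : (2 * X : k[X]).natDegree ≤ 1 := by
      exact (natDegree_C_mul_le (2 : k) X).trans natDegree_X_le
    refine natDegree_add_le_of_degree_le (natDegree_add_le_of_degree_le ?_ ?_) ?_
    · exact (natDegree_mul_le_of_le h1 (ih hx)).trans (by lia)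
    · rw [one_mul]; exact (ih hy).trans (by lia)
    · exact (natDegree_mul_le_of_le h2 (ih hz)).trans (by lia)

/-- The symmetric power `S^{n-2}`, understood to be zero for `n < 2`. -/
def lowPow (k : Type u) [Field k] : ℕ → Submodule k (SA k)
  | 0 => ⊥
  | 1 => ⊥
  | n + 2 => symPow k (sl2 k) n

lemma mul_mem_lowPow {n : ℕ} {a b : SA k} (ha : a ∈ symPow k (sl2 k) 1) (hb : b ∈ lowPow k n) :
    a * b ∈ lowPow k (n + 1) := by
  match n, hb with
  | 0, hb | 1, hb =>
    rw [show b = 0 from hb, mul_zero]; exact zero_mem _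
  | n + 2, hb =>
    have := mul_mem_symPow ha hb
    rwa [add_comm] at this

/-- The span of the monomials of degree `n` in which `h` occurs at most once. -/
def reducedSpan (k : Type u) [Field k] (n : ℕ) : Submodule k (SA k) :=
  Submodule.span k {a | (∃ j l, j + l = n ∧ a = genE k ^ j * genF k ^ l) ∨
    ∃ j l, j + l + 1 = n ∧ a = genE k ^ j * genF k ^ l * genH k}

lemma reducedSpan_le (n : ℕ) : reducedSpan k n ≤ symPow k (sl2 k) n := by
  refine Submodule.span_le.2 ?_
  rintro _ (⟨j, l, rfl, rfl⟩ | ⟨j, l, rfl, rfl⟩)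
  · simpa using mul_mem_symPow (pow_mem_symPow genE_mem j) (pow_mem_symPow genF_mem l)
  · simpa using mul_mem_symPow (mul_mem_symPow (pow_mem_symPow genE_mem j)
      (pow_mem_symPow genF_mem l)) genH_mem

/-- Modulo the Casimir element, `S^n` is spanned by the monomials in which `h` occurs at most
once, because `h²` may be replaced by `-4ef`. -/
lemma exists_reduced {n : ℕ} {a : SA k} (ha : a ∈ symPow k (sl2 k) n) :
    a ∈ reducedSpan k n ⊔ (lowPow k n).map (LinearMap.mulLeft k (casimir k)) := by
  induction n generalizing a with
  | zero =>
    rw [symPow, pow_zero, Submodule.mem_one] at ha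
    obtain ⟨r, rfl⟩ := ha
    refine Submodule.mem_sup_left ?_
    rw [Algebra.algebraMap_eq_smul_one]
    exact Submodule.smul_mem _ _ (Submodule.subset_span (Or.inl ⟨0, 0, rfl, by simp⟩))
  | succ n ih =>
    have step (t : SA k) (ht : t ∈ symPow k (sl2 k) 1)
        (hred : ∀ b ∈ reducedSpan k n, t * b ∈ reducedSpan k (n + 1) ⊔
          (lowPow k (n + 1)).map (LinearMap.mulLeft k (casimir k)))
        (b : SA k) (hb : b ∈ symPow k (sl2 k) n) : t * b ∈ reducedSpan k (n + 1) ⊔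
          (lowPow k (n + 1)).map (LinearMap.mulLeft k (casimir k)) := by
      obtain ⟨b₁, hb₁, _, ⟨b₂, hb₂, rfl⟩, rfl⟩ := Submodule.mem_sup.1 (ih hb)
      rw [mul_add]
      refine add_mem (hred _ hb₁) (Submodule.mem_sup_right ⟨t * b₂, mul_mem_lowPow ht hb₂, ?_⟩)
      simp only [LinearMap.mulLeft_apply]
      ring
    have span_step (t : SA k)
        (h1 : ∀ j l, j + l = n → t * (genE k ^ j * genF k ^ l) ∈ reducedSpan k (n + 1) ⊔
          (lowPow k (n + 1)).map (LinearMap.mulLeft k (casimir k)))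
        (h2 : ∀ j l, j + l + 1 = n → t * (genE k ^ j * genF k ^ l * genH k) ∈
          reducedSpan k (n + 1) ⊔ (lowPow k (n + 1)).map (LinearMap.mulLeft k (casimir k)))
        (b : SA k) (hb : b ∈ reducedSpan k n) : t * b ∈ reducedSpan k (n + 1) ⊔
          (lowPow k (n + 1)).map (LinearMap.mulLeft k (casimir k)) := by
      have hle : reducedSpan k n ≤ (reducedSpan k (n + 1) ⊔ (lowPow k (n + 1)).map
          (LinearMap.mulLeft k (casimir k))).comap (LinearMap.mulLeft k t) := by
        refine Submodule.span_le.2 ?_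
        rintro _ (⟨j, l, hjl, rfl⟩ | ⟨j, l, hjl, rfl⟩)
        · exact h1 j l hjl
        · exact h2 j l hjl
      exact hle hb
    obtain ⟨x, hx, y, hy, z, hz, rfl⟩ := exists_eq_of_mem_symPow_succ ha
    refine add_mem (add_mem (step _ genE_mem (span_step _ ?_ ?_) x hx)
      (step _ genF_mem (span_step _ ?_ ?_) y hy)) (step _ genH_mem (span_step _ ?_ ?_) z hz)
    · exact fun j l h => Submodule.mem_sup_left (Submodule.subset_span
        (Or.inl ⟨j + 1, l, by lia, by ring⟩))
    · exact fun j l h => Submodule.mem_sup_left (Submodule.subset_span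
        (Or.inr ⟨j + 1, l, by lia, by ring⟩))
    · exact fun j l h => Submodule.mem_sup_left (Submodule.subset_span
        (Or.inl ⟨j, l + 1, by lia, by ring⟩))
    · exact fun j l h => Submodule.mem_sup_left (Submodule.subset_span
        (Or.inr ⟨j, l + 1, by lia, by ring⟩))
    · exact fun j l h => Submodule.mem_sup_left (Submodule.subset_span
        (Or.inr ⟨j, l, by lia, by ring⟩))
    · intro j l h
      have e1 : genH k * (genE k ^ j * genF k ^ l * genH k) =
          (-4 : k) • (genE k ^ (j + 1) * genF k ^ (l + 1)) +
            LinearMap.mulLeft k (casimir k) (genE k ^ j * genF k ^ l) := by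
        have h4 : (-4 : k) • (genE k ^ (j + 1) * genF k ^ (l + 1)) =
            -(4 * (genE k ^ (j + 1) * genF k ^ (l + 1))) := by
          rw [neg_smul]
          congr 1
        rw [h4, LinearMap.mulLeft_apply, casimir]
        ring
      rw [e1]
      refine add_mem (Submodule.mem_sup_left (Submodule.smul_mem _ _ (Submodule.subset_span
        (Or.inl ⟨j + 1, l + 1, by lia, rfl⟩)))) (Submodule.mem_sup_right ⟨_, ?_, rfl⟩)
      subst h
      have := mul_mem_symPow (pow_mem_symPow (genE_mem (k := k)) j)
        (pow_mem_symPow (genF_mem (k := k)) l)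
      rw [one_mul, one_mul] at this
      exact this

/-- A linear section of `coneMap` on polynomials of degree at most `2n`, with values in `S^n`. -/
def coneSection (n : ℕ) : k[X] →ₗ[k] SA k :=
  Polynomial.lsum fun i => LinearMap.toSpanSingleton k (SA k)
    (((-1) ^ (i / 2) * (2⁻¹) ^ (i % 2) : k) •
      (genE k ^ (i / 2) * genF k ^ (n - i / 2 - i % 2) * genH k ^ (i % 2)))

lemma coneSection_monomial (n i : ℕ) (c : k) : coneSection n (monomial i c) =
    c • (((-1) ^ (i / 2) * (2⁻¹) ^ (i % 2) : k) •
      (genE k ^ (i / 2) * genF k ^ (n - i / 2 - i % 2) * genH k ^ (i % 2))) := by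
  simp [coneSection]

lemma coneMap_pow_mul_pow (j l : ℕ) :
    coneMap k (genE k ^ j * genF k ^ l) = monomial (2 * j) ((-1) ^ j) := by
  simp only [map_mul, map_pow, coneMap_genE, coneMap_genF, one_pow, mul_one]
  rw [neg_pow, ← pow_mul, ← C_mul_X_pow_eq_monomial]
  simp

lemma coneMap_pow_mul_pow_mul (j l : ℕ) :
    coneMap k (genE k ^ j * genF k ^ l * genH k) = monomial (2 * j + 1) ((-1) ^ j * 2) := by
  rw [map_mul, coneMap_pow_mul_pow, coneMap_genH, ← C_mul_X_pow_eq_monomial,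
    ← C_mul_X_pow_eq_monomial]
  simp only [map_mul, map_ofNat]
  ring

lemma coneSection_coneMap (h2 : (2 : k) ≠ 0) {n : ℕ} {a : SA k} (ha : a ∈ reducedSpan k n) :
    coneSection n (coneMap k a) = a := by
  have hle : reducedSpan k n ≤ LinearMap.eqLocus
      (coneSection n ∘ₗ (coneMap k).toLinearMap) LinearMap.id := by
    refine Submodule.span_le.2 ?_
    rintro _ (⟨j, l, rfl, rfl⟩ | ⟨j, l, rfl, rfl⟩)
    · change coneSection _ (coneMap k _) = _
      rw [coneMap_pow_mul_pow, coneSection_monomial, smul_smul]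
      have e1 : 2 * j / 2 = j := by lia
      have e2 : 2 * j % 2 = 0 := by lia
      rw [e1, e2]
      simp [← mul_pow]
    · change coneSection _ (coneMap k _) = _
      rw [coneMap_pow_mul_pow_mul, coneSection_monomial, smul_smul]
      have e1 : (2 * j + 1) / 2 = j := by lia
      have e2 : (2 * j + 1) % 2 = 1 := by lia
      have e3 : j + l + 1 - j - 1 = l := by lia
      rw [e1, e2, e3]
      have : ((-1) ^ j * 2 * ((-1) ^ j * 2⁻¹ ^ 1) : k) = 1 := by
        have : ((-1) ^ j * (-1) ^ j : k) = 1 := by rw [← mul_pow]; simp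
        field_simp
        linear_combination this
      rw [this]
      simp
  exact hle ha

/-- The kernel of the restriction to the nilpotent cone is generated by the Casimir element. -/
lemma exists_eq_casimir_mul (h2 : (2 : k) ≠ 0) {n : ℕ} {a : SA k}
    (ha : a ∈ symPow k (sl2 k) n) (h : coneMap k a = 0) :
    ∃ b ∈ lowPow k n, a = casimir k * b := by
  obtain ⟨x, hx, _, ⟨b, hb, rfl⟩, rfl⟩ := Submodule.mem_sup.1 (exists_reduced ha)
  rw [map_add, LinearMap.mulLeft_apply, map_mul, coneMap_casimir, zero_mul, add_zero] at h
  have hx0 : x = 0 := by rw [← coneSection_coneMap h2 hx, h, map_zero]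
  exact ⟨b, hb, by rw [hx0, zero_add, LinearMap.mulLeft_apply]⟩

lemma casimir_mul_mem {n : ℕ} {b : SA k} (hb : b ∈ lowPow k n) :
    casimir k * b ∈ symPow k (sl2 k) n := by
  match n, hb with
  | 0, hb | 1, hb =>
    rw [show b = 0 from hb, mul_zero]; exact zero_mem _
  | n + 2, hb =>
    have := mul_mem_symPow casimir_mem hb
    rwa [add_comm] at this

lemma exists_coneMap_eq (h2 : (2 : k) ≠ 0) {n : ℕ} {g : k[X]} (hg : g.natDegree ≤ 2 * n) :
    ∃ a ∈ symPow k (sl2 k) n, coneMap k a = g := by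
  suffices h : ∀ i ≤ 2 * n, ∀ c : k, monomial i c ∈
      (symPow k (sl2 k) n).map (coneMap k).toLinearMap by
    have hsum := g.as_sum_range_C_mul_X_pow' (n := 2 * n + 1) (by lia)
    rw [hsum]
    refine (Submodule.sum_mem _ fun i hi => ?_ : _ ∈ (symPow k (sl2 k) n).map
      (coneMap k).toLinearMap)
    rw [C_mul_X_pow_eq_monomial]
    exact h i (by simpa [Nat.lt_succ_iff] using hi) _
  intro i hi c
  rcases Nat.even_or_odd' i with ⟨j, rfl | rfl⟩
  · refine ⟨(c * (-1) ^ j) • (genE k ^ j * genF k ^ (n - j)), Submodule.smul_mem _ _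
      (reducedSpan_le _ (Submodule.subset_span (Or.inl ⟨j, n - j, by lia, rfl⟩))), ?_⟩
    rw [AlgHom.toLinearMap_apply, map_smul, coneMap_pow_mul_pow, smul_monomial, smul_eq_mul, mul_assoc, ← mul_pow]
    simp
  · refine ⟨(c * (-1) ^ j * 2⁻¹) • (genE k ^ j * genF k ^ (n - j - 1) * genH k),
      Submodule.smul_mem _ _ (reducedSpan_le _ (Submodule.subset_span
        (Or.inr ⟨j, n - j - 1, by lia, rfl⟩))), ?_⟩
    rw [AlgHom.toLinearMap_apply, map_smul, coneMap_pow_mul_pow_mul, smul_monomial, smul_eq_mul]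
    congr 1
    have : ((-1) ^ j * (-1) ^ j : k) = 1 := by rw [← mul_pow]; simp
    field_simp
    linear_combination c * this

end Cone

/-! ### Explicit cocycles and invariants in characteristic `p` -/

section Lifts

open Polynomial

variable {k : Type u} [Field k]

/-- The restriction of `a` to the nilpotent cone is a nonzero multiple of `X ^ N`. -/
def ConeMonomial (a : SA k) (N : ℕ) : Prop :=
  ∃ u : k, u ≠ 0 ∧ coneMap k a = monomial N u

lemma ConeMonomial.mul {a b : SA k} {M N : ℕ} (ha : ConeMonomial a M) (hb : ConeMonomial b N) :
    ConeMonomial (a * b) (M + N) := by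
  obtain ⟨u, hu, h1⟩ := ha
  obtain ⟨v, hv, h2⟩ := hb
  exact ⟨u * v, mul_ne_zero hu hv, by rw [map_mul, h1, h2, monomial_mul_monomial]⟩

lemma ConeMonomial.pow {a : SA k} {M : ℕ} (ha : ConeMonomial a M) (n : ℕ) :
    ConeMonomial (a ^ n) (M * n) := by
  obtain ⟨u, hu, h1⟩ := ha
  exact ⟨u ^ n, pow_ne_zero n hu, by rw [map_pow, h1, monomial_pow]⟩

lemma coneMonomial_genE : ConeMonomial (genE k) 2 :=
  ⟨-1, by simp, by rw [coneMap_genE, ← C_mul_X_pow_eq_monomial]; simp⟩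

lemma coneMonomial_genF : ConeMonomial (genF k) 0 :=
  ⟨1, one_ne_zero, by rw [coneMap_genF]; simp⟩

lemma coneMonomial_genH (h2 : (2 : k) ≠ 0) : ConeMonomial (genH k) 1 :=
  ⟨2, h2, by rw [coneMap_genH, ← C_mul_X_pow_eq_monomial, pow_one, map_ofNat]⟩

lemma genE_ne_zero : genE k ≠ 0 := by
  intro h
  have := coneMap_genE (k := k)
  rw [h, map_zero] at this
  simp at this

lemma genF_ne_zero : genF k ≠ 0 := by
  intro h
  have := coneMap_genF (k := k)
  rw [h, map_zero] at this
  simp at this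

lemma casimir_ne_zero : casimir k ≠ 0 := by
  -- Setting `e = f = 0` and `h = 1` sends the Casimir element to `1`.
  let φ : SA k →ₐ[k] k := SymmetricAlgebra.lift
    { toFun := fun x => x.1 0 0, map_add' := fun x y => by simp, map_smul' := fun c x => by simp }
  intro h
  have h1 : φ (casimir k) = 1 := by
    have he : φ (genE k) = 0 := (SymmetricAlgebra.lift_ι_apply _ _).trans
      (show (matE k).1 0 0 = 0 by simp [matE])
    have hh : φ (genH k) = 1 := (SymmetricAlgebra.lift_ι_apply _ _).trans
      (show (matH k).1 0 0 = 1 by simp [matH])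
    simp [casimir, he, hh]
  rw [h, map_zero] at h1
  exact zero_ne_one h1

lemma two_ne_zero_SA (h2 : (2 : k) ≠ 0) : (2 : SA k) ≠ 0 := by
  intro h
  have h1 : (2 : k) • (1 : SA k) = 0 := by rw [two_smul_eq_mul, h, zero_mul]
  exact (smul_ne_zero h2 one_ne_zero) h1

lemma cocycle_of_weight_two {n : ℕ} {a : SA k} (ha : a ∈ symPow k (sl2 k) n)
    (hH : derH k a = 2 * a) (hF : derF k a ∈ invariants k) :
    (a, 0, -derF k a) ∈ cocycles k n := by
  refine ⟨⟨ha, zero_mem _, neg_mem (derF_mem ha)⟩, ?_, ?_, ?_⟩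
  · simp
  · simp [hH, hF.1]
  · simp [hF.2.1]

lemma cocycle_of_weight_neg_two {n : ℕ} {b : SA k} (hb : b ∈ symPow k (sl2 k) n)
    (hH : derH k b = -2 * b) (hE : derE k b ∈ invariants k) :
    (0, b, derE k b) ∈ cocycles k n := by
  refine ⟨⟨zero_mem _, hb, derE_mem hb⟩, ?_, ?_, ?_⟩
  · simp
  · simp [hE.1]
  · simp [hH, hE.2.1]

/-- `a` has weight `2` in `S^n`, `f a` is invariant, and `a` restricts to a multiple of `X ^ N`
on the nilpotent cone. -/
structure RaisingLift (n N : ℕ) (a : SA k) : Prop where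
  mem : a ∈ symPow k (sl2 k) n
  derH_eq : derH k a = 2 * a
  derF_mem : derF k a ∈ invariants k
  cone : ConeMonomial a N

/-- `b` has weight `-2` in `S^n`, `e b` is invariant, and `b` restricts to a multiple of `X ^ N`
on the nilpotent cone. -/
structure LoweringLift (n N : ℕ) (b : SA k) : Prop where
  mem : b ∈ symPow k (sl2 k) n
  derH_eq : derH k b = -2 * b
  derE_mem : derE k b ∈ invariants k
  cone : ConeMonomial b N

/-- `w` is an invariant in `S^n` which restricts to a multiple of `X ^ N` on the nilpotent cone. -/
structure InvariantLift (n N : ℕ) (w : SA k) : Prop where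
  mem : w ∈ symPow k (sl2 k) n
  invariant : w ∈ invariants k
  cone : ConeMonomial w N

lemma InvariantLift.mul {m n M N : ℕ} {w v : SA k} (hw : InvariantLift m M w)
    (hv : InvariantLift n N v) : InvariantLift (m + n) (M + N) (w * v) :=
  ⟨mul_mem_symPow hw.mem hv.mem, mul_mem hw.invariant hv.invariant, hw.cone.mul hv.cone⟩

lemma InvariantLift.mul_raising {m n M N : ℕ} {w a : SA k} (hw : InvariantLift m M w)
    (ha : RaisingLift n N a) : RaisingLift (m + n) (M + N) (w * a) where
  mem := mul_mem_symPow hw.mem ha.mem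
  derH_eq := by
    rw [Derivation.leibniz, hw.invariant.2.2, ha.derH_eq, smul_eq_mul, smul_eq_mul]; ring
  derF_mem := by
    rw [Derivation.leibniz, hw.invariant.2.1, smul_zero, add_zero]
    exact mul_mem hw.invariant ha.derF_mem
  cone := hw.cone.mul ha.cone

lemma InvariantLift.mul_lowering {m n M N : ℕ} {w b : SA k} (hw : InvariantLift m M w)
    (hb : LoweringLift n N b) : LoweringLift (m + n) (M + N) (w * b) where
  mem := mul_mem_symPow hw.mem hb.mem
  derH_eq := by
    rw [Derivation.leibniz, hw.invariant.2.2, hb.derH_eq, smul_eq_mul, smul_eq_mul]; ring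
  derE_mem := by
    rw [Derivation.leibniz, hw.invariant.1, smul_zero, add_zero]
    exact mul_mem hw.invariant hb.derE_mem
  cone := hw.cone.mul hb.cone

variable (k) in
/-- The sum `∑ (h²)^i c^j` over `i + j = m - 1`, where `c` is the Casimir element. It is the
quotient of `h^{2m} - c^m` by `h² - c = -4ef`. -/
def geomH (m : ℕ) : SA k :=
  ∑ i ∈ Finset.range m, (genH k ^ 2) ^ i * casimir k ^ (m - 1 - i)

lemma geomH_mul (m : ℕ) :
    4 * (genE k * genF k) * geomH k m = casimir k ^ m - genH k ^ (2 * m) := by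
  have h := (Commute.all (genH k ^ 2) (casimir k)).geom_sum₂_mul m
  rw [← geomH, ← pow_mul] at h
  have h2 : genH k ^ 2 - casimir k = -(4 * (genE k * genF k)) := by rw [casimir]; ring
  rw [h2] at h
  linear_combination -h

lemma geomH_mem (m : ℕ) : geomH k m ∈ symPow k (sl2 k) (2 * (m - 1)) := by
  refine Submodule.sum_mem _ fun i hi => ?_
  have h1 := mul_mem_symPow (pow_mem_symPow (pow_mem_symPow (genH_mem (k := k)) 2) i)
    (pow_mem_symPow (casimir_mem (k := k)) (m - 1 - i))
  have : i < m := Finset.mem_range.1 hi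
  rwa [show 1 * 2 * i + 2 * (m - 1 - i) = 2 * (m - 1) by lia] at h1

lemma coneMonomial_geomH (h2 : (2 : k) ≠ 0) (m : ℕ) : ConeMonomial (geomH k (m + 1)) (2 * m) := by
  have h := ((coneMonomial_genH h2).pow 2).pow m
  obtain ⟨u, hu, h1⟩ := h
  refine ⟨u, hu, ?_⟩
  rw [show 2 * m = 1 * 2 * m by lia, ← h1, geomH, Finset.sum_range_succ, map_add, map_sum,
    Finset.sum_eq_zero]
  · simp
  · intro i hi
    have : i < m := Finset.mem_range.1 hi
    rw [map_mul, map_pow _ (casimir k), coneMap_casimir, zero_pow (by lia), mul_zero]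

lemma derH_genE_pow (N : ℕ) : derH k (genE k ^ N) = 2 * N * genE k ^ N := by
  induction N with
  | zero => simp
  | succ N ih =>
    rw [pow_succ, Derivation.leibniz, ih, derH_genE, smul_eq_mul, smul_eq_mul]; push_cast; ring

lemma derH_genF_pow (N : ℕ) : derH k (genF k ^ N) = -2 * N * genF k ^ N := by
  induction N with
  | zero => simp
  | succ N ih =>
    rw [pow_succ, Derivation.leibniz, ih, derH_genF, smul_eq_mul, smul_eq_mul]; push_cast; ring

lemma casimir_pow_mem_invariants (N : ℕ) : casimir k ^ N ∈ invariants k :=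
  pow_mem casimir_mem_invariants N

lemma four_mul_der (D : Derivation k (SA k) (SA k)) (a : SA k) : D (4 * a) = 4 * D a := by
  have h4 : D 4 = 0 := D.map_natCast 4
  rw [Derivation.leibniz, h4, smul_zero, add_zero, smul_eq_mul]

lemma mem_invariants_of_two_mul (h2 : (2 : k) ≠ 0) {a : SA k} (h : 2 * a ∈ invariants k) :
    a ∈ invariants k := by
  rw [← two_smul_eq_mul] at h
  have := (invariants k).smul_mem h (2⁻¹ : k)
  rwa [smul_smul, inv_mul_cancel₀ h2, one_smul] at this

section CharP

variable (p : ℕ) [CharP k p]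

lemma natCast_p_SA : (p : SA k) = 0 := by
  have : algebraMap k (SA k) (p : k) = (p : SA k) := map_natCast _ p
  rw [← this, CharP.cast_eq_zero, map_zero]

lemma pow_p_mem_invariants (a : SA k) : a ^ p ∈ invariants k := by
  refine ⟨?_, ?_, ?_⟩ <;>
    rw [Derivation.leibniz_pow, ← Nat.cast_smul_eq_nsmul (SA k), natCast_p_SA, zero_smul]

lemma invariantLift_pow {a : SA k} {N : ℕ} (ha : a ∈ symPow k (sl2 k) 1)
    (h : ConeMonomial a N) (x : ℕ) : InvariantLift (p * x) (N * (p * x)) (a ^ (p * x)) where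
  mem := by simpa using pow_mem_symPow ha (p * x)
  invariant := by rw [pow_mul]; exact pow_mem (pow_p_mem_invariants p a) x
  cone := h.pow _

lemma invariantLift_even (x y : ℕ) :
    InvariantLift (p * x + p * y) (2 * (p * x)) (genE k ^ (p * x) * genF k ^ (p * y)) := by
  have := (invariantLift_pow p genE_mem (coneMonomial_genE (k := k)) x).mul
    (invariantLift_pow p genF_mem (coneMonomial_genF (k := k)) y)
  simpa using this

lemma exists_invariantLift (h2 : (2 : k) ≠ 0) {q x : ℕ} (hx : x ≤ 2 * q) :
    ∃ w : SA k, InvariantLift (q * p) (p * x) w := by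
  rcases Nat.even_or_odd' x with ⟨j, rfl | rfl⟩
  · have h := invariantLift_even (k := k) p j (q - j)
    obtain ⟨l, rfl⟩ : ∃ l, q = j + l := ⟨q - j, by lia⟩
    rw [Nat.add_sub_cancel_left, show p * j + p * l = (j + l) * p by ring,
      show 2 * (p * j) = p * (2 * j) by ring] at h
    exact ⟨_, h⟩
  · have h := (invariantLift_even (k := k) p j (q - j - 1)).mul
      (invariantLift_pow p genH_mem (coneMonomial_genH h2) 1)
    obtain ⟨l, rfl⟩ : ∃ l, q = j + 1 + l := ⟨q - j - 1, by lia⟩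
    rw [show j + 1 + l - j - 1 = l by lia, show p * j + p * l + p * 1 = (j + 1 + l) * p by ring,
      show 2 * (p * j) + 1 * (p * 1) = p * (2 * j + 1) by ring] at h
    exact ⟨_, h⟩

variable {m : ℕ} (hm : p = 2 * m + 1)

include hm

lemma natCast_SA : (2 * m + 1 : SA k) = 0 := by
  have := natCast_p_SA (k := k) p
  rw [hm] at this
  exact_mod_cast this

lemma raisingLift_pow_mul (h2 : (2 : k) ≠ 0) :
    RaisingLift p 1 (genF k ^ (2 * m) * genH k) where
  mem := by
    have := mul_mem_symPow (pow_mem_symPow (genF_mem (k := k)) (2 * m)) genH_mem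
    rwa [one_mul, ← hm] at this
  derH_eq := by
    rw [Derivation.leibniz, derH_genF_pow, derH_genH, smul_eq_mul, smul_eq_mul]
    push_cast
    linear_combination (-2 * genF k ^ (2 * m) * genH k) * natCast_SA (k := k) p hm
  derF_mem := by
    have : derF k (genF k ^ (2 * m) * genH k) = genF k ^ p + genF k ^ p := by
      rw [Derivation.leibniz, Derivation.leibniz_pow, derF_genH, derF_genF, hm]
      simp only [smul_eq_mul, smul_zero, mul_zero, add_zero]
      ring
    rw [this]
    exact add_mem (pow_p_mem_invariants p _) (pow_p_mem_invariants p _)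
  cone := by
    have := (coneMonomial_genF.pow (2 * m)).mul (coneMonomial_genH h2)
    rwa [zero_mul, zero_add] at this

lemma loweringLift_pow_mul (h2 : (2 : k) ≠ 0) :
    LoweringLift p (p - 1 + p) (genE k ^ (2 * m) * genH k) where
  mem := by
    have := mul_mem_symPow (pow_mem_symPow (genE_mem (k := k)) (2 * m)) genH_mem
    rwa [one_mul, ← hm] at this
  derH_eq := by
    rw [Derivation.leibniz, derH_genE_pow, derH_genH, smul_eq_mul, smul_eq_mul]
    push_cast
    linear_combination (2 * genE k ^ (2 * m) * genH k) * natCast_SA (k := k) p hm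
  derE_mem := by
    have : derE k (genE k ^ (2 * m) * genH k) = -(genE k ^ p + genE k ^ p) := by
      rw [Derivation.leibniz, Derivation.leibniz_pow, derE_genH, derE_genE, hm]
      simp only [smul_eq_mul, smul_zero, mul_zero, add_zero]
      ring
    rw [this]
    exact neg_mem (add_mem (pow_p_mem_invariants p _) (pow_p_mem_invariants p _))
  cone := by
    have := (coneMonomial_genE.pow (2 * m)).mul (coneMonomial_genH h2)
    rwa [show 2 * (2 * m) + 1 = p - 1 + p by lia] at this

/-- The element `a` satisfies `4 f a = c ^ (m + 1) - h ^ (p + 1)` in the symmetric algebra. The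
derivation `derF` sends the right side to `-2 f h ^ p`, so that `derF a` is a multiple of the
invariant `h ^ p`. -/
lemma raisingLift_geom (h2 : (2 : k) ≠ 0) :
    RaisingLift p (p + 1) (genE k * geomH k (m + 1)) := by
  set a := genE k * geomH k (m + 1) with ha
  have key : 4 * (genF k * a) = casimir k ^ (m + 1) - genH k ^ p * genH k := by
    have h := geomH_mul (k := k) (m + 1)
    rw [ha, ← pow_succ, hm]
    linear_combination h
  clear_value a
  have h2' := two_ne_zero_SA h2
  have hc := casimir_pow_mem_invariants (k := k) (m + 1)
  have hh := pow_p_mem_invariants p (genH k)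
  refine ⟨?_, ?_, ?_, ?_⟩
  · have := mul_mem_symPow (genE_mem (k := k)) (geomH_mem (m + 1))
    rw [ha]
    rwa [show 1 + 2 * (m + 1 - 1) = p by lia] at this
  · have h := congrArg (derH k) key
    rw [four_mul_der, map_sub, hc.2.2, Derivation.leibniz, Derivation.leibniz, hh.2.2, derH_genF,
      derH_genH] at h
    simp only [smul_eq_mul] at h
    refine mul_left_cancel₀ (mul_ne_zero (mul_ne_zero h2' h2') (genF_ne_zero (k := k))) ?_
    linear_combination h
  · have h := congrArg (derF k) key
    rw [four_mul_der, map_sub, hc.2.1, Derivation.leibniz, Derivation.leibniz, hh.2.1, derF_genF,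
      derF_genH] at h
    simp only [smul_eq_mul] at h
    refine mem_invariants_of_two_mul h2 ?_
    have : 2 * derF k a = -genH k ^ p := by
      refine mul_left_cancel₀ (mul_ne_zero h2' (genF_ne_zero (k := k))) ?_
      linear_combination h
    rw [this]
    exact neg_mem hh
  · have := coneMonomial_genE.mul (coneMonomial_geomH h2 m)
    rw [ha]
    rwa [show 2 + 2 * m = p + 1 by lia] at this

lemma loweringLift_geom (h2 : (2 : k) ≠ 0) :
    LoweringLift p (p - 1) (genF k * geomH k (m + 1)) := by
  set b := genF k * geomH k (m + 1) with hb
  have key : 4 * (genE k * b) = casimir k ^ (m + 1) - genH k ^ p * genH k := by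
    have h := geomH_mul (k := k) (m + 1)
    rw [hb, ← pow_succ, hm]
    linear_combination h
  clear_value b
  have h2' := two_ne_zero_SA h2
  have hc := casimir_pow_mem_invariants (k := k) (m + 1)
  have hh := pow_p_mem_invariants p (genH k)
  refine ⟨?_, ?_, ?_, ?_⟩
  · have := mul_mem_symPow (genF_mem (k := k)) (geomH_mem (m + 1))
    rw [hb]
    rwa [show 1 + 2 * (m + 1 - 1) = p by lia] at this
  · have h := congrArg (derH k) key
    rw [four_mul_der, map_sub, hc.2.2, Derivation.leibniz, Derivation.leibniz, hh.2.2, derH_genE,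
      derH_genH] at h
    simp only [smul_eq_mul] at h
    refine mul_left_cancel₀ (mul_ne_zero (mul_ne_zero h2' h2') (genE_ne_zero (k := k))) ?_
    linear_combination h
  · have h := congrArg (derE k) key
    rw [four_mul_der, map_sub, hc.1, Derivation.leibniz, Derivation.leibniz, hh.1, derE_genE,
      derE_genH] at h
    simp only [smul_eq_mul] at h
    refine mem_invariants_of_two_mul h2 ?_
    have : 2 * derE k b = genH k ^ p := by
      refine mul_left_cancel₀ (mul_ne_zero h2' (genE_ne_zero (k := k))) ?_
      linear_combination h
    rw [this]
    exact hh
  · have := coneMonomial_genF.mul (coneMonomial_geomH h2 m)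
    rw [hb]
    rwa [show 0 + 2 * m = p - 1 by lia] at this

lemma raisingLift_pow : RaisingLift (p - 1) 0 (genF k ^ (2 * m)) where
  mem := by
    have := pow_mem_symPow (genF_mem (k := k)) (2 * m)
    rwa [show 1 * (2 * m) = p - 1 by lia] at this
  derH_eq := by
    rw [derH_genF_pow]
    push_cast
    linear_combination (-2 * genF k ^ (2 * m)) * natCast_SA (k := k) p hm
  derF_mem := by
    rw [Derivation.leibniz_pow, derF_genF, smul_zero, smul_zero]
    exact zero_mem _
  cone := by simpa using coneMonomial_genF.pow (2 * m)

lemma loweringLift_pow : LoweringLift (p - 1) (2 * (p - 1)) (genE k ^ (2 * m)) where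
  mem := by
    have := pow_mem_symPow (genE_mem (k := k)) (2 * m)
    rwa [show 1 * (2 * m) = p - 1 by lia] at this
  derH_eq := by
    rw [derH_genE_pow]
    push_cast
    linear_combination (2 * genE k ^ (2 * m)) * natCast_SA (k := k) p hm
  derE_mem := by
    rw [Derivation.leibniz_pow, derE_genE, smul_zero, smul_zero]
    exact zero_mem _
  cone := by
    have := (coneMonomial_genE (k := k)).pow (2 * m)
    rwa [show 2 * m = p - 1 by lia] at this ⊢

/-- The element `b` satisfies `4 e b = h c ^ m - h ^ p` in the symmetric algebra. The derivation
`derE` sends the right side to `-2 e c ^ m`, so that `derE b` is a multiple of the invariant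
`c ^ m`. -/
lemma loweringLift_mul_geom (h2 : (2 : k) ≠ 0) (hm0 : 0 < m) :
    LoweringLift (p - 1) (p - 2) (genF k * (genH k * geomH k m)) := by
  set b := genF k * (genH k * geomH k m) with hb
  have key : 4 * (genE k * b) = casimir k ^ m * genH k - genH k ^ p := by
    have h := geomH_mul (k := k) m
    rw [hb, hm, pow_succ]
    linear_combination genH k * h
  clear_value b
  have h2' := two_ne_zero_SA h2
  have hc := casimir_pow_mem_invariants (k := k) m
  have hh := pow_p_mem_invariants p (genH k)
  refine ⟨?_, ?_, ?_, ?_⟩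
  · have := mul_mem_symPow (genF_mem (k := k)) (mul_mem_symPow genH_mem (geomH_mem m))
    rw [hb]
    rwa [show 1 + (1 + 2 * (m - 1)) = p - 1 by lia] at this
  · have h := congrArg (derH k) key
    rw [four_mul_der, map_sub, hh.2.2, Derivation.leibniz, Derivation.leibniz, hc.2.2, derH_genE,
      derH_genH] at h
    simp only [smul_eq_mul] at h
    refine mul_left_cancel₀ (mul_ne_zero (mul_ne_zero h2' h2') (genE_ne_zero (k := k))) ?_
    linear_combination h
  · have h := congrArg (derE k) key
    rw [four_mul_der, map_sub, hh.1, Derivation.leibniz, Derivation.leibniz, hc.1, derE_genE,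
      derE_genH] at h
    simp only [smul_eq_mul] at h
    refine mem_invariants_of_two_mul h2 ?_
    have : 2 * derE k b = -casimir k ^ m := by
      refine mul_left_cancel₀ (mul_ne_zero h2' (genE_ne_zero (k := k))) ?_
      linear_combination h
    rw [this]
    exact neg_mem hc
  · obtain ⟨l, rfl⟩ : ∃ l, m = l + 1 := ⟨m - 1, by lia⟩
    have := coneMonomial_genF.mul ((coneMonomial_genH h2).mul (coneMonomial_geomH h2 l))
    rw [hb]
    rwa [show 0 + (1 + 2 * l) = p - 2 by lia] at this

end CharP

end Lifts

/-! ### Cocycles on the nilpotent cone -/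

section ConeCocycles

open Polynomial

variable {k : Type u} [Field k]

/-- A cocycle with values in the forms of degree `2n` on the nilpotent cone is a coboundary, unless
`n ≡ 0` or `n ≡ -1` in `k`; in these two cases it is one if certain coefficients agree. The
coefficients of a primitive can be chosen one at a time: away from the weight zero the value at `h`
determines them, and in weight zero the value at `e` does. -/
lemma exists_primitive (h2 : (2 : k) ≠ 0) {n : ℕ} {a b c : k[X]} (hda : a.natDegree ≤ 2 * n)
    (hdc : c.natDegree ≤ 2 * n) (h1 : c = opE n b - opF a)
    (h3 : 2 * a = opH n a - opE n c) (h4 : -2 * b = opH n b - opF c)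
    (hA : (n : k) + 1 = 0 → a.coeff 0 = 0 ∧ ∀ i : ℕ, (i : k) + 1 = n → a.coeff (i + 2) = b.coeff i)
    (hB : (n : k) = 0 → (∀ i : ℕ, (i : k) = 0 → a.coeff (i + 1) = 0) ∧
      ∀ i : ℕ, (i : k) + 1 = 0 → b.coeff i = 0) :
    ∃ g : k[X], g.natDegree ≤ 2 * n ∧ opE n g = a ∧ opF g = b ∧ opH n g = c := by
  have e1 (i : ℕ) : c.coeff (i + 1) = (2 * n - i) * b.coeff i - (i + 2) * a.coeff (i + 2) := by
    have := congrArg (fun t => t.coeff (i + 1)) h1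
    simp only [coeff_sub, coeff_opE_succ, coeff_opF] at this
    push_cast at this
    rw [this]; ring
  have e10 : c.coeff 0 = -a.coeff 1 := by
    have := congrArg (fun t => t.coeff 0) h1
    simp only [coeff_sub, coeff_opE_zero, coeff_opF] at this
    simpa using this
  have e3 (i : ℕ) : 2 * (i - n) * a.coeff (i + 1) = (2 * n - i) * c.coeff i := by
    have := congrArg (fun t => t.coeff (i + 1)) h3
    simp only [coeff_ofNat_mul, coeff_sub, coeff_opE_succ, coeff_opH] at this
    push_cast at this
    linear_combination -this
  have e30 : (n + 1) * a.coeff 0 = 0 := by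
    have := congrArg (fun t => t.coeff 0) h3
    simp only [coeff_ofNat_mul, coeff_sub, coeff_opE_zero, coeff_opH] at this
    push_cast at this
    refine mul_left_cancel₀ h2 ?_
    linear_combination this
  have e4 (i : ℕ) : 2 * (i + 1 - n) * b.coeff i = (i + 1) * c.coeff (i + 1) := by
    have := congrArg (fun t => t.coeff i) h4
    simp only [neg_mul, coeff_neg, coeff_ofNat_mul, coeff_sub, coeff_opF, coeff_opH] at this
    linear_combination -this
  -- In weight zero the value at `h` vanishes.
  have hc0 (i : ℕ) (hi : (i : k) = n) : c.coeff i = 0 := by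
    by_cases hn : (n : k) = 0
    · rw [hn] at hi
      obtain ⟨hB1, hB2⟩ := hB hn
      cases i with
      | zero => rw [e10, hB1 0 hi, neg_zero]
      | succ i =>
        push_cast at hi
        have := hB1 (i + 1) (by push_cast; exact hi)
        rw [e1, hB2 i hi, this]; ring
    · have h := e3 i
      rw [hi] at h
      refine mul_left_cancel₀ hn ?_
      linear_combination -h
  classical
  let γ : ℕ → k := fun i => if (i : k) = n then a.coeff (i + 1) / n else
    c.coeff i / (2 * (i - n))
  have hγ0 (i : ℕ) (hi : 2 * n < i) : γ i = 0 := by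
    simp only [γ, coeff_eq_zero_of_natDegree_lt (hdc.trans_lt hi),
      coeff_eq_zero_of_natDegree_lt (hda.trans_lt (hi.trans (Nat.lt_succ_self i))), zero_div,
      ite_self]
  let g : k[X] := ∑ i ∈ Finset.range (2 * n + 1), monomial i (γ i)
  have hg (i : ℕ) : g.coeff i = γ i := by
    simp only [g, finsetSum_coeff, coeff_monomial, Finset.sum_ite_eq', Finset.mem_range]
    split_ifs with h
    · rfl
    · exact (hγ0 i (by lia)).symm
  refine ⟨g, ?_, ?_, ?_, ?_⟩
  · refine natDegree_sum_le_of_forall_le _ _ fun i hi => ?_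
    have : i < 2 * n + 1 := Finset.mem_range.1 hi
    exact (natDegree_monomial_le _).trans (by lia)
  · ext i
    cases i with
    | zero =>
      rw [coeff_opE_zero]
      by_cases hn : (n : k) + 1 = 0
      · exact (hA hn).1.symm
      · exact ((mul_eq_zero.1 e30).resolve_left hn).symm
    | succ i =>
      rw [coeff_opE_succ, hg]
      simp only [γ]
      split_ifs with hi
      · by_cases hn : (n : k) = 0
        · rw [(hB hn).1 i (hi.trans hn)]; simp
        · rw [hi]; field_simp; ring
      · have : (i : k) - n ≠ 0 := sub_ne_zero.2 hi
        field_simp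
        linear_combination -e3 i
  · ext i
    rw [coeff_opF, hg]
    simp only [γ]
    push_cast
    split_ifs with hi
    · by_cases hn : (n : k) = 0
      · rw [(hB hn).2 i (hi.trans hn), hi, hn, zero_mul]
      · have hab : a.coeff (i + 2) = b.coeff i := by
          by_cases hn1 : (n : k) + 1 = 0
          · exact (hA hn1).2 i hi
          · have h := e1 i
            rw [hc0 (i + 1) (by push_cast; exact hi)] at h
            refine mul_left_cancel₀ hn1 ?_
            linear_combination h - (a.coeff (i + 2) + b.coeff i) * hi
        rw [hi, hab]; field_simp
    · have : (i : k) + 1 - n ≠ 0 := sub_ne_zero.2 hi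
      field_simp
      linear_combination -e4 i
  · ext i
    rw [coeff_opH, hg]
    simp only [γ]
    split_ifs with hi
    · rw [hc0 i hi, hi]; ring
    · have : (i : k) - n ≠ 0 := sub_ne_zero.2 hi
      field_simp

/-- Invariant forms on the nilpotent cone are polynomials in `X ^ p`, and lift to invariants of the
symmetric algebra. -/
lemma exists_invariant_lift (p : ℕ) [CharP k p] (hp : 0 < p) (h2 : (2 : k) ≠ 0) {n : ℕ} {g : k[X]}
    (hg : g.natDegree ≤ 2 * n) (hF : opF g = 0) (hH : opH n g = 0) :
    ∃ a ∈ symPow k (sl2 k) n, a ∈ invariants k ∧ coneMap k a = g := by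
  suffices h : g ∈ (symPow k (sl2 k) n ⊓ Subalgebra.toSubmodule (invariants k)).map
      (coneMap k).toLinearMap by
    obtain ⟨a, ⟨h1, h3⟩, h4⟩ := h
    exact ⟨a, h1, h3, h4⟩
  rw [g.as_sum_range' (2 * n + 1) (by lia)]
  refine Submodule.sum_mem _ fun i hi => ?_
  have hi2 : i ≤ 2 * n := by simpa [Nat.lt_succ_iff] using hi
  by_cases hgi : g.coeff i = 0
  · rw [hgi, monomial_zero_right]; exact zero_mem _
  have hi0 : (i : k) = 0 := by
    cases i with
    | zero => simp
    | succ i =>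
      have h := coeff_opF g i
      rw [hF, coeff_zero] at h
      push_cast
      exact (mul_eq_zero.1 h.symm).resolve_right hgi
  have hn0 : (n : k) = 0 := by
    have h := coeff_opH n g i
    rw [hH, coeff_zero, hi0] at h
    have h5 := (mul_eq_zero.1 h.symm).resolve_right hgi
    refine mul_left_cancel₀ h2 ?_
    linear_combination -h5
  obtain ⟨x, rfl⟩ := (CharP.cast_eq_zero_iff k p i).1 hi0
  obtain ⟨q, rfl⟩ := (CharP.cast_eq_zero_iff k p n).1 hn0
  have hx : x ≤ 2 * q := by
    refine Nat.le_of_mul_le_mul_left ?_ hp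
    linarith
  obtain ⟨w, hw⟩ := exists_invariantLift (k := k) p h2 hx
  obtain ⟨u, hu, hwu⟩ := hw.cone
  refine ⟨(g.coeff (p * x) / u) • w, Submodule.smul_mem _ _ ⟨by rw [mul_comm]; exact hw.mem,
    hw.invariant⟩, ?_⟩
  rw [AlgHom.toLinearMap_apply, map_smul, hwu, smul_monomial, smul_eq_mul, div_mul_cancel₀ _ hu]

end ConeCocycles

/-! ### The dimension count -/

section Count

open Polynomial

variable {k : Type u} [Field k]

/-- The cocycles with values in `S^{n-2}`, understood to be zero for `n < 2`. -/
def lowCocycles (k : Type u) [Field k] : ℕ → Submodule k (SA k × SA k × SA k)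
  | 0 => ⊥
  | 1 => ⊥
  | n + 2 => cocycles k n

instance lowCocycles_finite (n : ℕ) : Module.Finite k (lowCocycles k n) := by
  match n with
  | 0 | 1 => exact inferInstanceAs (Module.Finite k (⊥ : Submodule k (SA k × SA k × SA k)))
  | n + 2 => exact cocycles_finite n

variable (k) in
/-- Multiplication of triples by the Casimir element. -/
def casimirMul : (SA k × SA k × SA k) →ₗ[k] SA k × SA k × SA k :=
  (LinearMap.mulLeft k (casimir k)).prodMap
    ((LinearMap.mulLeft k (casimir k)).prodMap (LinearMap.mulLeft k (casimir k)))

lemma casimirMul_apply (z : SA k × SA k × SA k) :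
    casimirMul k z = (casimir k * z.1, casimir k * z.2.1, casimir k * z.2.2) := rfl

lemma casimirMul_injective : Function.Injective (casimirMul k) := by
  intro z w h
  have hc := casimir_ne_zero (k := k)
  simp only [casimirMul_apply, Prod.mk.injEq, mul_right_inj' hc] at h
  exact Prod.ext h.1 (Prod.ext h.2.1 h.2.2)

lemma der_casimir_mul (a : SA k) : derE k (casimir k * a) = casimir k * derE k a ∧
    derF k (casimir k * a) = casimir k * derF k a ∧
    derH k (casimir k * a) = casimir k * derH k a := by
  have h := casimir_mem_invariants (k := k)
  refine ⟨?_, ?_, ?_⟩ <;> rw [Derivation.leibniz]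
  · rw [h.1, smul_zero, add_zero, smul_eq_mul]
  · rw [h.2.1, smul_zero, add_zero, smul_eq_mul]
  · rw [h.2.2, smul_zero, add_zero, smul_eq_mul]

lemma coboundary_casimir_mul (a : SA k) :
    coboundary k (casimir k * a) = casimirMul k (coboundary k a) := by
  obtain ⟨h1, h2, h3⟩ := der_casimir_mul a
  simp only [coboundary_apply, casimirMul_apply, h1, h2, h3]

lemma casimirMul_mem {n : ℕ} {z : SA k × SA k × SA k} (hz : z ∈ lowCocycles k n) :
    casimirMul k z ∈ cocycles k n := by
  match n, hz with
  | 0, hz | 1, hz => rw [show z = 0 from hz, map_zero]; exact zero_mem _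
  | n + 2, hz =>
    obtain ⟨⟨h1, h2, h3⟩, h4, h5, h6⟩ := hz
    have hm {b : SA k} (hb : b ∈ symPow k (sl2 k) n) : casimir k * b ∈ symPow k (sl2 k) (n + 2) :=
      casimir_mul_mem hb
    refine ⟨⟨hm h1, hm h2, hm h3⟩, ?_, ?_, ?_⟩ <;>
      simp only [casimirMul_apply, (der_casimir_mul _).1, (der_casimir_mul _).2.1,
        (der_casimir_mul _).2.2]
    · linear_combination casimir k * h4
    · linear_combination casimir k * h5
    · linear_combination casimir k * h6

lemma mem_lowCocycles {n : ℕ} {z : SA k × SA k × SA k} (h1 : z.1 ∈ lowPow k n)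
    (h2 : z.2.1 ∈ lowPow k n) (h3 : z.2.2 ∈ lowPow k n) (hz : casimirMul k z ∈ cocycles k n) :
    z ∈ lowCocycles k n := by
  match n, hz with
  | 0, hz | 1, hz => exact Prod.ext h1 (Prod.ext h2 h3)
  | n + 2, hz =>
    have hc := casimir_ne_zero (k := k)
    obtain ⟨-, h4, h5, h6⟩ := hz
    simp only [casimirMul_apply, (der_casimir_mul _).1, (der_casimir_mul _).2.1,
      (der_casimir_mul _).2.2] at h4 h5 h6
    refine ⟨⟨h1, h2, h3⟩, ?_, ?_, ?_⟩ <;> refine mul_left_cancel₀ hc ?_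
    · linear_combination h4
    · linear_combination h5
    · linear_combination h6

/-- The coboundaries with values in `S^{n-2}`, understood to be zero for `n < 2`. -/
def lowCoboundaries (k : Type u) [Field k] (n : ℕ) : Submodule k (SA k × SA k × SA k) :=
  (lowPow k n).map (coboundary k)

lemma lowCoboundaries_le (n : ℕ) : lowCoboundaries k n ≤ lowCocycles k n := by
  match n with
  | 0 | 1 => rintro _ ⟨a, ha, rfl⟩; rw [show a = 0 from ha, map_zero]; exact zero_mem _
  | n + 2 => exact coboundaries_le_cocycles n

lemma exists_casimirMul_eq (h2 : (2 : k) ≠ 0) {n : ℕ} {z : SA k × SA k × SA k}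
    (hz : z ∈ cocycles k n) (h1 : coneMap k z.1 = 0) (h3 : coneMap k z.2.1 = 0)
    (h4 : coneMap k z.2.2 = 0) : ∃ y ∈ lowCocycles k n, casimirMul k y = z := by
  obtain ⟨a, ha, ha'⟩ := exists_eq_casimir_mul h2 hz.1.1 h1
  obtain ⟨b, hb, hb'⟩ := exists_eq_casimir_mul h2 hz.1.2.1 h3
  obtain ⟨c, hc, hc'⟩ := exists_eq_casimir_mul h2 hz.1.2.2 h4
  have : casimirMul k (a, b, c) = z := by
    rw [casimirMul_apply, ← ha', ← hb', ← hc']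
  exact ⟨(a, b, c), mem_lowCocycles ha hb hc (this ▸ hz), this⟩

/-- The values at `e` and `f` of a triple, restricted to the nilpotent cone. -/
def coneValues (k : Type u) [Field k] : (SA k × SA k × SA k) →ₗ[k] k[X] × k[X] :=
  ((coneMap k).toLinearMap ∘ₗ LinearMap.fst _ _ _).prod
    ((coneMap k).toLinearMap ∘ₗ LinearMap.fst _ _ _ ∘ₗ LinearMap.snd _ _ _)

lemma coneValues_apply (z : SA k × SA k × SA k) :
    coneValues k z = (coneMap k z.1, coneMap k z.2.1) := rfl

/-- If `Λ` identifies the cohomology of the forms of degree `2n` on the nilpotent cone with `W`, and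
the classes and the invariants on the cone lift to `S^n`, then the dimension of `H¹(S^n)` exceeds
that of `H¹(S^{n-2})` by the dimension of `W`. -/
lemma finrank_cocycles_step (h2 : (2 : k) ≠ 0) {W : Type*} [AddCommGroup W] [Module k W]
    (p : ℕ) [CharP k p] (hp : 0 < p) (n : ℕ) (Λ : k[X] × k[X] →ₗ[k] W)
    (hcob : ∀ g : k[X], Λ (opE n g, opF g) = 0)
    (hA : ∀ a b : k[X], a.natDegree ≤ 2 * n → b.natDegree ≤ 2 * n → Λ (a, b) = 0 →
      (n : k) + 1 = 0 → a.coeff 0 = 0 ∧ ∀ i : ℕ, (i : k) + 1 = n → a.coeff (i + 2) = b.coeff i)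
    (hB : ∀ a b : k[X], a.natDegree ≤ 2 * n → b.natDegree ≤ 2 * n → Λ (a, b) = 0 →
      (n : k) = 0 → (∀ i : ℕ, (i : k) = 0 → a.coeff (i + 1) = 0) ∧
        ∀ i : ℕ, (i : k) + 1 = 0 → b.coeff i = 0)
    (hsurj : (cocycles k n).map (Λ ∘ₗ coneValues k) = ⊤) :
    Module.finrank k (cocycles k n) + Module.finrank k (lowCoboundaries k n) =
      Module.finrank k W + Module.finrank k (lowCocycles k n) +
        Module.finrank k (coboundaries k n) := by
  set Θ := Λ ∘ₗ coneValues k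
  set K := cocycles k n ⊓ LinearMap.ker Θ with hK
  have hcone (z) (hz : z ∈ cocycles k n) :
      coneMap k z.2.2 = opE n (coneMap k z.2.1) - opF (coneMap k z.1) ∧
      2 * coneMap k z.1 = opH n (coneMap k z.1) - opE n (coneMap k z.2.2) ∧
      -2 * coneMap k z.2.1 = opH n (coneMap k z.2.1) - opF (coneMap k z.2.2) := by
    obtain ⟨⟨h1, h3, h4⟩, h5, h6, h7⟩ := hz
    have g5 := congrArg (coneMap k) h5
    have g6 := congrArg (coneMap k) h6
    have g7 := congrArg (coneMap k) h7
    rw [map_sub] at g5 g6 g7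
    rw [(coneMap_der h3).1, (coneMap_der h1).2.1] at g5
    rw [(coneMap_der h1).2.2, (coneMap_der h4).1, map_mul, map_ofNat] at g6
    rw [(coneMap_der h3).2.2, (coneMap_der h4).2.1, map_mul, map_neg, map_ofNat] at g7
    exact ⟨g5, g6, g7⟩
  have hKsup : K = coboundaries k n ⊔ (lowCocycles k n).map (casimirMul k) := by
    apply le_antisymm
    · rintro z ⟨hz, hz0⟩
      have hz0' : Λ (coneMap k z.1, coneMap k z.2.1) = 0 := hz0
      have d1 := natDegree_coneMap_le hz.1.1
      have d2 := natDegree_coneMap_le hz.1.2.1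
      obtain ⟨c1, c2, c3⟩ := hcone z hz
      obtain ⟨g, hg, g1, g2, g3⟩ := exists_primitive h2 d1 (natDegree_coneMap_le hz.1.2.2)
        c1 c2 c3 (hA _ _ d1 d2 hz0') (hB _ _ d1 d2 hz0')
      obtain ⟨a, ha, rfl⟩ := exists_coneMap_eq h2 hg
      obtain ⟨a1, a2, a3⟩ := coneMap_der ha
      have hδ : coboundary k a ∈ coboundaries k n := ⟨a, ha, rfl⟩
      obtain ⟨y, hy, hyz⟩ := exists_casimirMul_eq h2
        (sub_mem hz (coboundaries_le_cocycles n hδ)) (by simp [a1, g1]) (by simp [a2, g2])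
        (by simp [a3, g3])
      exact Submodule.mem_sup.2 ⟨_, hδ, _, ⟨y, hy, rfl⟩, by rw [hyz]; abel⟩
    · refine sup_le ?_ ?_
      · rintro _ ⟨a, ha, rfl⟩
        refine ⟨coboundaries_le_cocycles n ⟨a, ha, rfl⟩, ?_⟩
        change Λ (coneMap k (derE k a), coneMap k (derF k a)) = 0
        rw [(coneMap_der ha).1, (coneMap_der ha).2.1, hcob]
      · rintro _ ⟨y, hy, rfl⟩
        refine ⟨casimirMul_mem hy, ?_⟩
        change Λ (coneMap k (casimir k * y.1), coneMap k (casimir k * y.2.1)) = 0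
        rw [map_mul, map_mul, coneMap_casimir, zero_mul, zero_mul]
        exact map_zero Λ
  -- A coboundary divisible by the Casimir element is the coboundary of a multiple of it: its
  -- primitive is invariant on the cone, hence invariant up to such a multiple.
  have hinf : coboundaries k n ⊓ (lowCocycles k n).map (casimirMul k) =
      (lowCoboundaries k n).map (casimirMul k) := by
    apply le_antisymm
    · rintro _ ⟨⟨a, ha, rfl⟩, ⟨y, hy, hya⟩⟩
      rw [coboundary_apply, casimirMul_apply, Prod.mk.injEq, Prod.mk.injEq] at hya
      obtain ⟨a1, a2, a3⟩ := coneMap_der ha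
      rw [← hya.2.1, map_mul, coneMap_casimir, zero_mul] at a2
      rw [← hya.2.2, map_mul, coneMap_casimir, zero_mul] at a3
      obtain ⟨w, hw, hwi, hwa⟩ := exists_invariant_lift p hp h2 (natDegree_coneMap_le ha)
        a2.symm a3.symm
      obtain ⟨b, hb, hab⟩ := exists_eq_casimir_mul h2 (sub_mem ha hw)
        (by rw [map_sub, hwa, sub_self])
      refine ⟨coboundary k b, ⟨b, hb, rfl⟩, ?_⟩
      rw [← coboundary_casimir_mul, ← hab, map_sub]
      have : coboundary k w = 0 := by rw [coboundary_apply, hwi.1, hwi.2.1, hwi.2.2]; rfl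
      rw [this, sub_zero]
    · rintro _ ⟨_, ⟨b, hb, rfl⟩, rfl⟩
      refine ⟨⟨casimir k * b, casimir_mul_mem hb, coboundary_casimir_mul b⟩, ?_⟩
      exact ⟨_, lowCoboundaries_le n ⟨b, hb, rfl⟩, rfl⟩
  have f1 := LinearMap.finrank_range_add_finrank_ker (Θ.domRestrict (cocycles k n))
  rw [LinearMap.range_domRestrict, hsurj, finrank_top] at f1
  have f2 : Module.finrank k (LinearMap.ker (Θ.domRestrict (cocycles k n))) =
      Module.finrank k K := by
    have e : LinearMap.ker (Θ.domRestrict (cocycles k n)) = K.comap (cocycles k n).subtype := by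
      ext z
      simp [hK]
    rw [e]
    exact (Submodule.comapSubtypeEquivOfLe inf_le_left).finrank_eq
  have f3 := Submodule.finrank_sup_add_finrank_inf_eq (coboundaries k n)
    ((lowCocycles k n).map (casimirMul k))
  rw [← hKsup, hinf,
    ← (Submodule.equivMapOfInjective _ casimirMul_injective (lowCocycles k n)).finrank_eq,
    ← (Submodule.equivMapOfInjective _ casimirMul_injective (lowCoboundaries k n)).finrank_eq] at f3
  lia

end Count

/-! ### The cohomology classes on the nilpotent cone -/

section Functionals

open Polynomial

variable {k : Type u} [Field k]

lemma eq_top_of_single_mem {N : ℕ} {R : Submodule k (Fin N → k)}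
    (h : ∀ x, ∃ u : k, u ≠ 0 ∧ Pi.single x u ∈ R) : R = ⊤ := by
  rw [eq_top_iff]
  intro w _
  rw [← Finset.univ_sum_single w]
  refine Submodule.sum_mem _ fun x _ => ?_
  obtain ⟨u, hu, hx⟩ := h x
  have := R.smul_mem (w x / u) hx
  rwa [← Pi.single_smul, smul_eq_mul, div_mul_cancel₀ _ hu] at this

/-- The coefficients `a_{px+1}` and `b_{px+p-1}` for `x < 2q`. For `n = qp` these are the
coefficients of the values at `e` and `f` that vanish on every coboundary, and they are coordinates
on the cohomology of the forms of degree `2n`. -/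
def functionalZero (k : Type u) [Field k] (p q : ℕ) :
    k[X] × k[X] →ₗ[k] (Fin (2 * q) → k) × (Fin (2 * q) → k) :=
  (LinearMap.pi fun x : Fin (2 * q) => lcoeff k (p * x + 1)).prodMap
    (LinearMap.pi fun x : Fin (2 * q) => lcoeff k (p * x + (p - 1)))

lemma functionalZero_apply (p q : ℕ) (a b : k[X]) : functionalZero k p q (a, b) =
    (fun x : Fin (2 * q) => a.coeff (p * x + 1), fun x : Fin (2 * q) =>
      b.coeff (p * x + (p - 1))) := rfl

/-- The coefficients of `a - X² b` at `X ^ (px)` for `x ≤ 2q + 2`. For `n = qp + p - 1` a monomial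
of weight zero has the coboundary `a = -X ^ (px)`, `b = -X ^ (px - 2)`, so that only these
differences are determined by the class of a cocycle; they are coordinates on the cohomology of the
forms of degree `2n`. -/
def functionalNegOne (k : Type u) [Field k] (p q : ℕ) :
    k[X] × k[X] →ₗ[k] (Fin (2 * q + 3) → k) :=
  LinearMap.pi fun x : Fin (2 * q + 3) => lcoeff k (p * x) ∘ₗ
    (LinearMap.fst k k[X] k[X] - LinearMap.mulLeft k (X ^ 2 : k[X]) ∘ₗ LinearMap.snd k k[X] k[X])

lemma functionalNegOne_apply (p q : ℕ) (a b : k[X]) (x : Fin (2 * q + 3)) :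
    functionalNegOne k p q (a, b) x = (a - X ^ 2 * b).coeff (p * x) := rfl

lemma coeff_monomial_mul_add {p : ℕ} (hp : 0 < p) {N : ℕ} (x y : Fin N) (c : ℕ) (u : k) :
    (monomial (p * x + c) u).coeff (p * (y : ℕ) + c) = (Pi.single x u : Fin N → k) y := by
  rw [coeff_monomial, Pi.single_apply]
  congr 1
  simp only [Nat.add_right_cancel_iff, Nat.mul_right_inj hp.ne', Fin.val_inj, eq_comm]

variable {p : ℕ} [CharP k p]

lemma raisingLift_mem_map {n N : ℕ} {a : SA k} (ha : RaisingLift n N a) {W : Type*}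
    [AddCommGroup W] [Module k W] (Λ : k[X] × k[X] →ₗ[k] W) :
    ∃ u : k, u ≠ 0 ∧ Λ (monomial N u, 0) ∈ (cocycles k n).map (Λ ∘ₗ coneValues k) := by
  obtain ⟨u, hu, h⟩ := ha.cone
  refine ⟨u, hu, _, cocycle_of_weight_two ha.mem ha.derH_eq ha.derF_mem, ?_⟩
  rw [LinearMap.comp_apply, coneValues_apply, h, map_zero]

lemma loweringLift_mem_map {n N : ℕ} {b : SA k} (hb : LoweringLift n N b) {W : Type*}
    [AddCommGroup W] [Module k W] (Λ : k[X] × k[X] →ₗ[k] W) :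
    ∃ u : k, u ≠ 0 ∧ Λ (0, monomial N u) ∈ (cocycles k n).map (Λ ∘ₗ coneValues k) := by
  obtain ⟨u, hu, h⟩ := hb.cone
  refine ⟨u, hu, _, cocycle_of_weight_neg_two hb.mem hb.derH_eq hb.derE_mem, ?_⟩
  rw [LinearMap.comp_apply, coneValues_apply, h, map_zero]

lemma exists_raisingLift_zero (hodd : Odd p) (h2 : (2 : k) ≠ 0) {q x : ℕ}
    (hx : x < 2 * q) : ∃ a : SA k, RaisingLift (q * p) (p * x + 1) a := by
  obtain ⟨m, hm⟩ := hodd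
  rcases Nat.even_or_odd' x with ⟨j, rfl | rfl⟩ <;>
    obtain ⟨l, rfl⟩ : ∃ l, q = j + l + 1 := ⟨q - j - 1, by lia⟩
  · have h := (invariantLift_even (k := k) p j l).mul_raising (raisingLift_pow_mul p hm h2)
    rw [show p * j + p * l + p = (j + l + 1) * p by ring,
      show 2 * (p * j) + 1 = p * (2 * j) + 1 by ring] at h
    exact ⟨_, h⟩
  · have h := (invariantLift_even (k := k) p j l).mul_raising (raisingLift_geom p hm h2)
    rw [show p * j + p * l + p = (j + l + 1) * p by ring,
      show 2 * (p * j) + (p + 1) = p * (2 * j + 1) + 1 by ring] at h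
    exact ⟨_, h⟩

lemma exists_loweringLift_zero (hodd : Odd p) (h2 : (2 : k) ≠ 0) {q x : ℕ}
    (hx : x < 2 * q) : ∃ b : SA k, LoweringLift (q * p) (p * x + (p - 1)) b := by
  obtain ⟨m, hm⟩ := hodd
  rcases Nat.even_or_odd' x with ⟨j, rfl | rfl⟩ <;>
    obtain ⟨l, rfl⟩ : ∃ l, q = j + l + 1 := ⟨q - j - 1, by lia⟩
  · have h := (invariantLift_even (k := k) p j l).mul_lowering (loweringLift_geom p hm h2)
    rw [show p * j + p * l + p = (j + l + 1) * p by ring,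
      show 2 * (p * j) + (p - 1) = p * (2 * j) + (p - 1) by ring] at h
    exact ⟨_, h⟩
  · have h := (invariantLift_even (k := k) p j l).mul_lowering (loweringLift_pow_mul p hm h2)
    rw [show p * j + p * l + p = (j + l + 1) * p by ring,
      show 2 * (p * j) + (p - 1 + p) = p * (2 * j + 1) + (p - 1) by ring] at h
    exact ⟨_, h⟩

lemma map_functionalZero (hp : 2 < p) (hodd : Odd p) (h2 : (2 : k) ≠ 0) (q : ℕ) :
    (cocycles k (q * p)).map (functionalZero k p q ∘ₗ coneValues k) = ⊤ := by
  set R := (cocycles k (q * p)).map (functionalZero k p q ∘ₗ coneValues k)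
  have h1 : R.comap (LinearMap.inl k _ _) = ⊤ := by
    refine eq_top_of_single_mem fun x => ?_
    obtain ⟨a, ha⟩ := exists_raisingLift_zero hodd h2 x.2
    obtain ⟨u, hu, h⟩ := raisingLift_mem_map ha (functionalZero k p q)
    refine ⟨u, hu, ?_⟩
    have e : ((Pi.single x u, 0) : (Fin (2 * q) → k) × (Fin (2 * q) → k)) =
        functionalZero k p q (monomial (p * x + 1) u, 0) :=
      Prod.ext (funext fun y => (coeff_monomial_mul_add (by lia) x y 1 u).symm) rfl
    rw [← e] at h
    exact h
  have h3 : R.comap (LinearMap.inr k _ _) = ⊤ := by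
    refine eq_top_of_single_mem fun x => ?_
    obtain ⟨b, hb⟩ := exists_loweringLift_zero hodd h2 x.2
    obtain ⟨u, hu, h⟩ := loweringLift_mem_map hb (functionalZero k p q)
    refine ⟨u, hu, ?_⟩
    have e : ((0, Pi.single x u) : (Fin (2 * q) → k) × (Fin (2 * q) → k)) =
        functionalZero k p q (0, monomial (p * x + (p - 1)) u) :=
      Prod.ext rfl (funext fun y => (coeff_monomial_mul_add (by lia) x y (p - 1) u).symm)
    rw [← e] at h
    exact h
  rw [eq_top_iff]
  rintro ⟨v, w⟩ -
  have hv : LinearMap.inl k _ _ v ∈ R := (h1 ▸ Submodule.mem_top : v ∈ R.comap _)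
  have hw : LinearMap.inr k _ _ w ∈ R := (h3 ▸ Submodule.mem_top : w ∈ R.comap _)
  simpa using add_mem hv hw

lemma X_sq_mul_monomial (N : ℕ) (u : k) : X ^ 2 * monomial N u = monomial (N + 2) u := by
  rw [X_pow_mul, monomial_mul_X_pow]

lemma map_functionalNegOne (hp : 2 < p) (hodd : Odd p) (h2 : (2 : k) ≠ 0) (q : ℕ) :
    (cocycles k (q * p + (p - 1))).map (functionalNegOne k p q ∘ₗ coneValues k) = ⊤ := by
  obtain ⟨m, hm⟩ := hodd
  have hlow {N : ℕ} {b : SA k} (x : Fin (2 * q + 3)) (hN : N + 2 = p * x)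
      (hb : LoweringLift (q * p + (p - 1)) N b) :
      ∃ u : k, u ≠ 0 ∧ Pi.single x u ∈
        (cocycles k (q * p + (p - 1))).map (functionalNegOne k p q ∘ₗ coneValues k) := by
    obtain ⟨u, hu, h⟩ := loweringLift_mem_map hb (functionalNegOne k p q)
    refine ⟨-u, neg_ne_zero.2 hu, ?_⟩
    convert h using 1
    ext y
    rw [functionalNegOne_apply, zero_sub, X_sq_mul_monomial, hN, coeff_neg, Pi.single_neg,
      Pi.neg_apply]
    exact congrArg Neg.neg (coeff_monomial_mul_add (by lia) x y 0 u).symm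
  refine eq_top_of_single_mem fun x => ?_
  obtain ⟨x, hx⟩ := x
  rcases Nat.even_or_odd' x with ⟨j, rfl | rfl⟩
  · rcases Nat.lt_or_ge q j with hj | hj
    · obtain rfl : j = q + 1 := by lia
      have h := (invariantLift_even (k := k) p q 0).mul_lowering (loweringLift_pow p hm)
      rw [show p * q + p * 0 + (p - 1) = q * p + (p - 1) by ring] at h
      refine hlow _ ?_ h
      obtain ⟨l, rfl⟩ : ∃ l, p = l + 1 := ⟨p - 1, by lia⟩
      simp only [Nat.add_sub_cancel]
      ring
    · obtain ⟨l, rfl⟩ : ∃ l, q = j + l := ⟨q - j, by lia⟩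
      have h := (invariantLift_even (k := k) p j l).mul_raising (raisingLift_pow p hm)
      rw [show p * j + p * l + (p - 1) = (j + l) * p + (p - 1) by ring] at h
      obtain ⟨u, hu, h⟩ := raisingLift_mem_map h (functionalNegOne k p (j + l))
      refine ⟨u, hu, ?_⟩
      convert h using 1
      ext y
      rw [functionalNegOne_apply, mul_zero, sub_zero,
        show 2 * (p * j) + 0 = p * (2 * j) + 0 by ring]
      exact (coeff_monomial_mul_add (by lia) ⟨2 * j, hx⟩ y 0 u).symm
  · obtain ⟨l, rfl⟩ : ∃ l, q = j + l := ⟨q - j, by lia⟩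
    have h := (invariantLift_even (k := k) p j l).mul_lowering
      (loweringLift_mul_geom p hm h2 (by lia))
    rw [show p * j + p * l + (p - 1) = (j + l) * p + (p - 1) by ring] at h
    refine hlow _ ?_ h
    obtain ⟨l, rfl⟩ : ∃ l, p = l + 2 := ⟨p - 2, by lia⟩
    simp only [Nat.add_sub_cancel]
    ring

lemma functionalZero_coboundary (hp : 2 < p) (q : ℕ) (g : k[X]) :
    functionalZero k p q (opE (q * p) g, opF g) = 0 := by
  have hp0 : (p : k) = 0 := CharP.cast_eq_zero k p
  rw [functionalZero_apply]
  refine Prod.ext (funext fun x => ?_) (funext fun x => ?_)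
  · dsimp only
    rw [coeff_opE_succ]
    push_cast
    rw [hp0]
    simp
  · dsimp only
    have : ((p * x + (p - 1) : ℕ) : k) + 1 = 0 := by
      have h : ((p * x + (p - 1) + 1 : ℕ) : k) = 0 := by
        rw [show p * (x : ℕ) + (p - 1) + 1 = p * (x + 1) by
          rw [mul_add]; lia]
        push_cast
        rw [hp0, zero_mul]
      exact_mod_cast h
    rw [coeff_opF, this, zero_mul]
    rfl

lemma functionalNegOne_coboundary (hp : 2 < p) (q : ℕ) (g : k[X]) :
    functionalNegOne k p q (opE (q * p + (p - 1)) g, opF g) = 0 := by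
  have hp0 : (p : k) = 0 := CharP.cast_eq_zero k p
  ext ⟨x, hx⟩
  rw [functionalNegOne_apply, coeff_sub, Pi.zero_apply]
  rcases Nat.eq_zero_or_pos x with rfl | hx0
  · simp [coeff_opE_zero]
  · obtain ⟨i, hi⟩ : ∃ i, p * x = i + 2 := ⟨p * x - 2, by
      have : p ≤ p * x := Nat.le_mul_of_pos_right p hx0
      lia⟩
    have hi' : (i : k) + 2 = 0 := by
      have : ((i + 2 : ℕ) : k) = 0 := by rw [← hi]; push_cast; rw [hp0, zero_mul]
      exact_mod_cast this
    have hn' : ((q * p + (p - 1) : ℕ) : k) + 1 = 0 := by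
      have : ((q * p + (p - 1) + 1 : ℕ) : k) = 0 := by
        rw [show q * p + (p - 1) + 1 = (q + 1) * p by rw [add_mul]; lia]
        push_cast
        rw [hp0, mul_zero]
      exact_mod_cast this
    simp only [hi]
    rw [coeff_X_pow_mul, show i + 2 = (i + 1) + 1 by rfl, coeff_opE_succ, coeff_opF]
    push_cast at hn' ⊢
    linear_combination g.coeff (i + 1) * (2 * hn' - 2 * hi')

lemma finrank_cocycles_add (hp : 2 < p) (hodd : Odd p) (h2 : (2 : k) ≠ 0) {n q r : ℕ}
    (hr : r < p) (hn : n = q * p + r) :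
    Module.finrank k (cocycles k n) + Module.finrank k (lowCoboundaries k n) =
      (if r = 0 then 4 * q else if r = p - 1 then 2 * q + 3 else 0) +
        Module.finrank k (lowCocycles k n) + Module.finrank k (coboundaries k n) := by
  have hp0 : (p : k) = 0 := CharP.cast_eq_zero k p
  have hnr : (n : k) = r := by rw [hn]; push_cast; rw [hp0]; simp
  have hzero : (n : k) = 0 ↔ r = 0 := by
    rw [hnr, CharP.cast_eq_zero_iff k p]
    exact ⟨fun h => Nat.eq_zero_of_dvd_of_lt h hr, fun h => h ▸ dvd_zero p⟩
  have hneg : (n : k) + 1 = 0 ↔ r = p - 1 := by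
    have : (r : k) + 1 = ((r + 1 : ℕ) : k) := by push_cast; rfl
    rw [hnr, this, CharP.cast_eq_zero_iff k p]
    refine ⟨fun h => ?_, fun h => ?_⟩
    · have := Nat.le_of_dvd (Nat.succ_pos r) h
      lia
    · rw [h, Nat.sub_add_cancel (by lia)]
  by_cases h0 : r = 0
  · rw [if_pos h0]
    obtain rfl : n = q * p := by lia
    have := finrank_cocycles_step h2 p (by lia) (q * p) (functionalZero k p q)
      (functionalZero_coboundary hp q) (fun a b _ _ _ h => absurd (hneg.1 h) (by lia)) ?_
      (map_functionalZero hp hodd h2 q)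
    · rw [this, Module.finrank_prod, Module.finrank_fin_fun]
      lia
    · intro a b ha hb hab _
      rw [functionalZero_apply] at hab
      have h1 := congrArg Prod.fst hab
      have h3 := congrArg Prod.snd hab
      refine ⟨fun i hi => ?_, fun i hi => ?_⟩
      · obtain ⟨x, rfl⟩ := (CharP.cast_eq_zero_iff k p i).1 hi
        by_cases hx : x < 2 * q
        · exact congrFun h1 ⟨x, hx⟩
        · exact coeff_eq_zero_of_natDegree_lt (ha.trans_lt (by nlinarith))
      · have hi' : ((i + 1 : ℕ) : k) = 0 := by exact_mod_cast hi
        obtain ⟨x, hx'⟩ := (CharP.cast_eq_zero_iff k p (i + 1)).1 hi'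
        obtain ⟨y, rfl⟩ : ∃ y, x = y + 1 := ⟨x - 1, by
          rcases Nat.eq_zero_or_pos x with rfl | h
          · simp at hx'
          · lia⟩
        obtain rfl : i = p * y + (p - 1) := by rw [mul_add] at hx'; lia
        by_cases hx : y < 2 * q
        · exact congrFun h3 ⟨y, hx⟩
        · refine coeff_eq_zero_of_natDegree_lt (hb.trans_lt ?_)
          have : 2 * (q * p) ≤ p * y := by nlinarith
          lia
  · rw [if_neg h0]
    by_cases h1 : r = p - 1
    · rw [if_pos h1]
      rw [h1] at hn
      subst hn
      have := finrank_cocycles_step h2 p (by lia) (q * p + (p - 1)) (functionalNegOne k p q)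
        (functionalNegOne_coboundary hp q) ?_ (fun a b _ _ _ h => absurd (hzero.1 h) h0)
        (map_functionalNegOne hp hodd h2 q)
      · rw [this, Module.finrank_fin_fun]
      · intro a b ha hb hab hn1
        have hx (x : ℕ) : (a - X ^ 2 * b).coeff (p * x) = 0 := by
          by_cases hx : x < 2 * q + 3
          · exact congrFun hab ⟨x, hx⟩
          · have hlt : 2 * (q * p + (p - 1)) + 2 < p * x := by
              have : p * (2 * q + 3) ≤ p * x := Nat.mul_le_mul_left p (by lia)
              have e : p * (2 * q + 3) = 2 * (q * p) + 3 * p := by ring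
              lia
            have hdeg : (X ^ 2 * b).natDegree ≤ 2 * (q * p + (p - 1)) + 2 :=
              (natDegree_mul_le_of_le (natDegree_X_pow_le 2) hb).trans (by lia)
            rw [coeff_sub, coeff_eq_zero_of_natDegree_lt (ha.trans_lt (by lia)),
              coeff_eq_zero_of_natDegree_lt (hdeg.trans_lt hlt), sub_zero]
        refine ⟨?_, fun i hi => ?_⟩
        · have := hx 0
          simpa using this
        · have hi' : ((i + 2 : ℕ) : k) = 0 := by
            push_cast
            push_cast at hi hn1
            linear_combination hi + hn1
          obtain ⟨x, hx'⟩ := (CharP.cast_eq_zero_iff k p (i + 2)).1 hi'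
          have := hx x
          rwa [← hx', coeff_sub, coeff_X_pow_mul, sub_eq_zero] at this
    · rw [if_neg h1]
      have := finrank_cocycles_step h2 p (by lia) n (0 : k[X] × k[X] →ₗ[k] (Fin 0 → k))
        (fun g => rfl) (fun a b _ _ _ h => absurd (hneg.1 h) h1)
        (fun a b _ _ _ h => absurd (hzero.1 h) h0) (Subsingleton.elim _ _)
      rw [this, Module.finrank_fin_fun]

/-- The dimension of `Ext¹_U(k, S^n)` exceeds that of `Ext¹_U(k, S^{n-2})` by the dimension of
the cohomology of the nilpotent cone in degree `n`. -/
lemma finrank_ext_add_two (hp : 2 < p) (hodd : Odd p) (h2 : (2 : k) ≠ 0) {n q r : ℕ}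
    (hr : r < p) (hn : n + 2 = q * p + r) :
    Module.finrank k (Abelian.Ext (triv k) (S k (n + 2)) 1) =
      (if r = 0 then 4 * q else if r = p - 1 then 2 * q + 3 else 0) +
        Module.finrank k (Abelian.Ext (triv k) (S k n) 1) := by
  have h1 := finrank_cocycles_add hp hodd h2 hr hn
  have h3 := (finrank_ext_add_finrank_coboundaries (k := k) n).2
  have h4 := (finrank_ext_add_finrank_coboundaries (k := k) (n + 2)).2
  change _ + Module.finrank k (coboundaries k n) = _ + Module.finrank k (cocycles k n) + _ at h1
  lia

lemma finrank_ext_of_lt_two (hp : 2 < p) (hodd : Odd p) (h2 : (2 : k) ≠ 0) {n : ℕ} (hn : n < 2) :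
    Module.finrank k (Abelian.Ext (triv k) (S k n) 1) = 0 := by
  have h1 := finrank_cocycles_add hp hodd h2 (n := n) (q := 0) (r := n) (by lia) (by simp)
  have h4 := (finrank_ext_add_finrank_coboundaries (k := k) n).2
  have h5 : lowPow k n = ⊥ ∧ lowCocycles k n = ⊥ := by
    match n, hn with
    | 0, _ | 1, _ => exact ⟨rfl, rfl⟩
  have hp1 : p ≠ 2 := by lia
  have h6 : (if n = 0 then 4 * 0 else if n = p - 1 then 2 * 0 + 3 else 0) = 0 := by
    split_ifs <;> lia
  rw [lowCoboundaries, h5.1, h5.2, Submodule.map_bot, finrank_bot, h6] at h1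
  lia

/-- The solution of the recursion. All the dimensions are written in terms of `C(q, 2)` and `q`,
which makes the recursion linear. -/
lemma finrank_ext_eq (hp : 2 < p) (hodd : Odd p) (h2 : (2 : k) ≠ 0) (n : ℕ) :
    ∀ q r : ℕ, r < p → n = q * p + r →
    Module.finrank k (Abelian.Ext (triv k) (S k n) 1) =
      3 * q.choose 2 + if r = p - 1 then 6 * q + 3 else if Even r then 4 * q else 3 * q := by
  induction n using Nat.strong_induction_on with
  | _ n ih =>
  intro q r hr hn
  have hpe : Even (p - 1) := by
    obtain ⟨m, hm⟩ := hodd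
    exact ⟨m, by lia⟩
  have hcs (q : ℕ) : (q + 1).choose 2 = q + q.choose 2 := by
    rw [Nat.choose_succ_succ' q 1, Nat.choose_one_right]
  rcases Nat.lt_or_ge n 2 with hn2 | hn2
  · have hq : q = 0 := by
      by_contra h
      have : p ≤ q * p := Nat.le_mul_of_pos_left p (Nat.pos_of_ne_zero h)
      lia
    rw [finrank_ext_of_lt_two hp hodd h2 hn2, hq, if_neg (by lia)]
    simp
  · obtain ⟨n, rfl⟩ : ∃ l, n = l + 2 := ⟨n - 2, by lia⟩
    rw [finrank_ext_add_two hp hodd h2 hr hn]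
    rcases Nat.lt_or_ge r 2 with hr2 | hr2
    · obtain ⟨q, rfl⟩ : ∃ l, q = l + 1 := ⟨q - 1, by
        rcases Nat.eq_zero_or_pos q with rfl | h
        · lia
        · lia⟩
      rw [add_mul, one_mul] at hn
      obtain rfl | rfl : r = 0 ∨ r = 1 := by lia
      · have h1 : ¬ Even (p - 2) := by
          obtain ⟨m, hm⟩ := hodd
          rw [Nat.not_even_iff_odd]
          exact ⟨m - 1, by lia⟩
        rw [ih n (by lia) q (p - 2) (by lia) (by lia), if_pos rfl, if_neg (by lia), if_neg h1,
          if_neg (by lia), if_pos Even.zero, hcs]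
        ring
      · rw [ih n (by lia) q (p - 1) (by lia) (by lia), if_neg (by lia), if_neg (by lia),
          if_pos rfl, if_neg (by lia), if_neg (by simp), hcs]
        ring
    · have hE : Even (r - 2) ↔ Even r := by
        rw [Nat.even_sub hr2]; simp
      rw [ih n (by lia) q (r - 2) (by lia) (by lia), if_neg (by lia),
        if_neg (show r - 2 ≠ p - 1 by lia)]
      simp only [hE]
      by_cases h1 : r = p - 1
      · rw [if_pos h1, if_pos h1, if_pos (h1 ▸ hpe)]
        ring
      · rw [if_neg h1, if_neg h1, zero_add]

end Functionals

end SymAdjoint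

end

theorem mainTheorem5 (k : Type u) [Field k] (p : ℕ) [CharP k p] (hp : 2 < p)
    (n q r : ℕ) (hr : r ≤ p - 1) (hn : n = q * p + r) :
    Module.Finite k (Abelian.Ext (SymAdjoint.triv k) (SymAdjoint.S k n) 1) ∧
    (r = p - 1 →
      (Module.finrank k (Abelian.Ext (SymAdjoint.triv k) (SymAdjoint.S k n) 1) : ℤ) =
        3 * (q + 2).choose 2) ∧
    (r ≠ p - 1 → Even r →
      (Module.finrank k (Abelian.Ext (SymAdjoint.triv k) (SymAdjoint.S k n) 1) : ℤ) =
        4 * (q + 1).choose 2 - q.choose 2) ∧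
    (Odd r →
      (Module.finrank k (Abelian.Ext (SymAdjoint.triv k) (SymAdjoint.S k n) 1) : ℤ) =
        3 * (q + 1).choose 2) := by
  have hprime : p.Prime := by
    rcases CharP.char_is_prime_or_zero k p with h | h
    · exact h
    · lia
  have hodd : Odd p := hprime.odd_of_ne_two (by lia)
  have h2 : (2 : k) ≠ 0 := by
    have h : ¬ ((2 : ℕ) : k) = 0 := by
      rw [CharP.cast_eq_zero_iff k p]
      exact fun h => absurd (Nat.le_of_dvd (by lia) h) (by lia)
    exact_mod_cast h
  have hmain := SymAdjoint.finrank_ext_eq hp hodd h2 n q r (by lia) hn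
  have hcs (q : ℕ) : (q + 1).choose 2 = q + q.choose 2 := by
    rw [Nat.choose_succ_succ' q 1, Nat.choose_one_right]
  refine ⟨(SymAdjoint.finrank_ext_add_finrank_coboundaries n).1, fun h => ?_, fun h he => ?_,
    fun ho => ?_⟩
  · rw [hmain, if_pos h, hcs (q + 1), hcs q]
    push_cast
    ring
  · rw [hmain, if_neg h, if_pos he, hcs q]
    push_cast
    ring
  · have h : r ≠ p - 1 := by
      obtain ⟨m, hm⟩ := hodd
      obtain ⟨l, hl⟩ := ho
      lia
    rw [hmain, if_neg h, if_neg (Nat.not_even_iff_odd.2 ho), hcs q]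
    push_cast
    ring
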